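/- Let $n\ge 0$ and let $1\le i_1<i_2<\dots<i_k<n$ be integers (possibly none, $k=0$), and put $m=i_1+\dots+i_k$. Then there is a bijection $$\{\pi\in\mathcal I_n(123):\operatorname{Asc}(\pi)=\{i_1,\dots,i_k\}\}\longrightarrow\{\lambda\vdash m:\operatorname{hd}(\lambda)=\{i_1,\dots,i_k\},\ \lambda\subseteq B_n\}.$$ Here $\mathcal I_n(123)$ is the set of permutations $\pi$ of $\{1,\dots,n\}$ with $\pi=\pi^{-1}$ for which there are no $a<b<c$ with $\pi(a)<\pi(b)<\pi(c)$, and $\operatorname{Asc}(\pi)=\{i: 1\le i<n,\ \pi(i)<\pi(i+1)\}$. The notation $\lambda\vdash m$ means that $\lambda=(\lambda_1\ge\lambda_2\ge\cdots)$ is a partition of $m$, and $\lambda\subseteq B_n$ means that its Young diagram, with rows of lengths $\lambda_1,\lambda_2,\dots$, fits inside the box $B_n$ with $\lfloor n/2\rfloor$ rows and $\lceil n/2\rceil$ columns. The hook decomposition $\operatorname{hd}(\lambda)$ is the set of the sizes of the hooks obtained by repeatedly removing the largest hook (first row together with first column) from the Young diagram of $\lambda$ until nothing remains; the number of these hooks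 is the side of the Durfee square of $\lambda$, i.e. the largest $d$ such that $d=0$ or $\lambda_d\ge d$. -/

import Mathlib

/-- The ascent set `Asc(π)` of a permutation of `{1, …, n}`: the positions `1 ≤ i < n` with
`π(i) < π(i+1)`. The element `a : Fin n` stands for the number `a + 1`. -/
def ascentSet {n : ℕ} (π : Equiv.Perm (Fin n)) : Finset ℕ :=
  {i ∈ Finset.Ico 1 n | ∃ a b : Fin n, (a : ℕ) + 1 = i ∧ (b : ℕ) + 1 = i + 1 ∧ π a < π b}

/-- `π` avoids the pattern `123`. -/
def Avoids123 {n : ℕ} (π : Equiv.Perm (Fin n)) : Prop :=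
  ¬ ∃ a b c : Fin n, a < b ∧ b < c ∧ π a < π b ∧ π b < π c

/-- `𝓘ₙ(123)`: the `123`-avoiding involutions (the identity counts as an involution). -/
def involutions123 (n : ℕ) : Set (Equiv.Perm (Fin n)) :=
  {π | π = π⁻¹ ∧ Avoids123 π}

/-- The cells of the largest hook of a Young diagram: its first row and its first column. -/
def YoungDiagram.largestHook (μ : YoungDiagram) : Finset (ℕ × ℕ) :=
  μ.row 0 ∪ μ.col 0

/-- The Young diagram that remains after the largest hook is removed, moved one step up and one
step left so that its corner is at the origin again. -/
def YoungDiagram.removeHook (μ : YoungDiagram) : YoungDiagram where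
  cells := (μ.cells \ μ.largestHook).image fun c => (c.1 - 1, c.2 - 1)
  isLowerSet := by
    rintro ⟨a, b⟩ ⟨c, d⟩ hle h
    obtain ⟨h1, h2⟩ := Prod.mk_le_mk.1 hle
    simp only [Finset.coe_image, Set.mem_image, Finset.mem_coe, Finset.mem_sdiff,
      largestHook, Finset.mem_union, mem_row_iff, mem_col_iff, mem_cells, Prod.mk.injEq] at h ⊢
    obtain ⟨⟨x, y⟩, ⟨hxy, hn⟩, rfl, rfl⟩ := h
    have hx : x ≠ 0 := fun h0 => hn (Or.inl ⟨hxy, h0⟩)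
    have hy : y ≠ 0 := fun h0 => hn (Or.inr ⟨hxy, h0⟩)
    refine ⟨(c + 1, d + 1), ⟨μ.up_left_mem ?_ ?_ hxy, ?_⟩, rfl, rfl⟩
    · dsimp only at h1; omega
    · dsimp only at h2; omega
    · simp

theorem YoungDiagram.mem_removeHook {μ : YoungDiagram} {i j : ℕ} :
    (i, j) ∈ μ.removeHook ↔ (i + 1, j + 1) ∈ μ := by
  rw [← mem_cells]
  simp only [removeHook, Finset.mem_image, Finset.mem_sdiff, largestHook, Finset.mem_union,
    mem_row_iff, mem_col_iff, mem_cells, Prod.mk.injEq]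
  constructor
  · rintro ⟨⟨x, y⟩, ⟨hxy, hn⟩, rfl, rfl⟩
    have hx : x ≠ 0 := fun h0 => hn (Or.inl ⟨hxy, h0⟩)
    have hy : y ≠ 0 := fun h0 => hn (Or.inr ⟨hxy, h0⟩)
    refine μ.up_left_mem ?_ ?_ hxy <;> dsimp only <;> omega
  · intro h
    exact ⟨(i + 1, j + 1), ⟨h, by simp⟩, rfl, rfl⟩

/-- The side of the Durfee square: the largest `k` such that the `k`-th row has at least `k`
cells. Row `k` is `rowLen (k - 1)`; the condition holds trivially for `k = 0`, and a positive `k`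
that satisfies it is at most the number of rows, `colLen 0`. -/
def YoungDiagram.durfeeSide (μ : YoungDiagram) : ℕ :=
  Nat.findGreatest (fun k => k ≤ μ.rowLen (k - 1)) (μ.colLen 0)

/-- The hook decomposition: the sizes of the largest hooks of the diagrams obtained by peeling
off `0, 1, …, k - 1` hooks, where `k` is the side of the Durfee square. -/
def YoungDiagram.hookDecomposition (μ : YoungDiagram) : Finset ℕ :=
  (Finset.range μ.durfeeSide).image fun r => (YoungDiagram.removeHook^[r] μ).largestHook.card

/-- The Young diagram of a partition (English convention): row `i` (counted from `0`) has as
many cells as the `i`-th part in weakly decreasing order. -/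
def Nat.Partition.youngDiagram {m : ℕ} (p : Nat.Partition m) : YoungDiagram :=
  YoungDiagram.ofRowLens (p.parts.sort (· ≥ ·)) (Multiset.pairwise_sort _ _).sortedGE

/-- The hook decomposition `hd(λ)` of a partition. -/
def Nat.Partition.hookDecomposition {m : ℕ} (p : Nat.Partition m) : Finset ℕ :=
  p.youngDiagram.hookDecomposition

/-- `λ ⊆ Bₙ`: the Young diagram fits inside the box with `⌊n/2⌋` rows and `⌈n/2⌉` columns. -/
def Nat.Partition.FitsInBox {m : ℕ} (p : Nat.Partition m) (n : ℕ) : Prop :=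
  p.youngDiagram.cells ⊆ Finset.range (n / 2) ×ˢ Finset.range ((n + 1) / 2)

/-- The sequences `s` of length `q` with values at most `p` that encode words with `p` letters `U`
and `q` letters `D` (`s r` letters `U` precede the `r`-th letter `D`) for which reversal on the
letters `U` and on the letters `D` is a `123`-avoiding involution whose left-to-right minima are the
letters `U`. -/
structure Admissible (p q : ℕ) (s : ℕ → ℕ) : Prop where
  mono : ∀ r, r + 1 < q → s r ≤ s (r + 1)
  le : ∀ r < q, s r ≤ p
  gt : ∀ r < q, p < s r + s (q - 1 - r)

/-- The state of the greedy matching of the letters `D` with letters `U` before the `r`-th `D`: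
the letter `U` that was matched last. -/
def greedyLevel (p q : ℕ) (s : ℕ → ℕ) : ℕ → ℕ
  | 0 => 0
  | r + 1 =>
    if max (greedyLevel p q s r) (p - s (q - 1 - r)) < s r then
      max (greedyLevel p q s r) (p - s (q - 1 - r)) + 1
    else greedyLevel p q s r

/-- The `r`-th letter `D` is matched by the greedy algorithm. -/
def GreedyMatched (p q : ℕ) (s : ℕ → ℕ) (r : ℕ) : Prop :=
  max (greedyLevel p q s r) (p - s (q - 1 - r)) < s r

instance (p q : ℕ) (s : ℕ → ℕ) : DecidablePred (GreedyMatched p q s) :=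
  fun r => inferInstanceAs (Decidable (max _ _ < s r))

/-- The positions of the matched letters `D`. -/
def matchedPositions (p q : ℕ) (s : ℕ → ℕ) : Finset ℕ :=
  ((Finset.range q).filter (GreedyMatched p q s)).image fun r => s r + r

namespace Admissible

variable {p q : ℕ} {s : ℕ → ℕ}

theorem mono_le (h : Admissible p q s) {i j : ℕ} (hij : i ≤ j) (hj : j < q) : s i ≤ s j := by
  induction j, hij using Nat.le_induction with
  | base => rfl
  | succ j hij ih => exact (ih (by omega)).trans (h.mono j hj)

theorem lt_of_add_lt (h : Admissible p q s) {i j : ℕ} (hi : i < q) (hij : s i + i < s j + j) :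
    i < j := by
  by_contra hc
  have := h.mono_le (not_lt.1 hc) hi
  omega

theorem add_lt_iff (h : Admissible p q s) {i j : ℕ} (hi : i < q) (hj : j < q) :
    s i + i < s j + j ↔ i < j := by
  refine ⟨h.lt_of_add_lt hi, fun hij => ?_⟩
  have := h.mono_le hij.le hj
  omega

theorem add_inj (h : Admissible p q s) {i j : ℕ} (hi : i < q) (hj : j < q)
    (hij : s i + i = s j + j) : i = j := by
  have h1 := h.add_lt_iff hi hj
  have h2 := h.add_lt_iff hj hi
  omega

theorem add_lt (h : Admissible p q s) {r : ℕ} (hr : r < q) : s r + r < p + q := by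
  have := h.le r hr
  omega

theorem lt_self (h : Admissible p q s) {r : ℕ} (hr : r < q) : p - s (q - 1 - r) < s r := by
  have h1 := h.gt r hr
  have h2 := h.le (q - 1 - r) (by omega)
  omega

theorem matched_iff (h : Admissible p q s) {r : ℕ} (hr : r < q) :
    GreedyMatched p q s r ↔ greedyLevel p q s r < s r := by
  have := h.lt_self hr
  simp [GreedyMatched, this]

theorem level_succ_of_matched {r : ℕ} (hr : GreedyMatched p q s r) :
    greedyLevel p q s (r + 1) = max (greedyLevel p q s r) (p - s (q - 1 - r)) + 1 :=
  if_pos hr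

theorem level_succ_of_not_matched {r : ℕ} (hr : ¬ GreedyMatched p q s r) :
    greedyLevel p q s (r + 1) = greedyLevel p q s r :=
  if_neg hr

theorem level_bounds (h : Admissible p q s) {r : ℕ} (hr : r < q) :
    greedyLevel p q s r ≤ s r ∧ greedyLevel p q s (r + 1) ≤ s r := by
  have key : ∀ r < q, greedyLevel p q s r ≤ s r → greedyLevel p q s (r + 1) ≤ s r := by
    intro r hr h1
    by_cases hm : GreedyMatched p q s r
    · rw [level_succ_of_matched hm]; exact hm
    · rwa [level_succ_of_not_matched hm]
  induction r with
  | zero => exact ⟨Nat.zero_le _, key 0 hr (Nat.zero_le _)⟩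
  | succ r ih =>
    have h1 := (ih (by omega)).2.trans (h.mono r hr)
    exact ⟨h1, key _ hr h1⟩

theorem lt_level_succ (h : Admissible p q s) {r : ℕ} (hr : r < q) :
    p - s (q - 1 - r) < greedyLevel p q s (r + 1) := by
  by_cases hm : GreedyMatched p q s r
  · rw [level_succ_of_matched hm]; omega
  · rw [level_succ_of_not_matched hm]
    have h1 := h.lt_self hr
    rw [h.matched_iff hr] at hm
    omega

theorem level_succ_le (p q : ℕ) (s : ℕ → ℕ) (r : ℕ) :
    greedyLevel p q s (r + 1) ≤ max (greedyLevel p q s r) (p - s (q - 1 - r)) + 1 := by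
  by_cases hm : GreedyMatched p q s r
  · rw [level_succ_of_matched hm]
  · rw [level_succ_of_not_matched hm]; omega

theorem min_le_level_succ (h : Admissible p q s) {r : ℕ} (hr : r < q) :
    min (greedyLevel p q s r + 1) (s r) ≤ greedyLevel p q s (r + 1) := by
  by_cases hm : GreedyMatched p q s r
  · rw [level_succ_of_matched hm]; omega
  · rw [level_succ_of_not_matched hm]
    rw [h.matched_iff hr] at hm
    omega

theorem card_matched_le (p q : ℕ) (s : ℕ → ℕ) (r : ℕ) :
    ((Finset.range r).filter (GreedyMatched p q s)).card ≤ greedyLevel p q s r := by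
  induction r with
  | zero => simp
  | succ r ih =>
    rw [Finset.range_add_one, Finset.filter_insert]
    split_ifs with hm
    · rw [Finset.card_insert_of_notMem (by simp), level_succ_of_matched hm]; omega
    · rwa [level_succ_of_not_matched hm]

end Admissible

/-- The number of letters `D` among the first `x` letters. -/
def countBelow (Z : Finset ℕ) (x : ℕ) : ℕ := (Z.filter (· < x)).card

theorem countBelow_zero (Z : Finset ℕ) : countBelow Z 0 = 0 := by simp [countBelow]

theorem countBelow_succ (Z : Finset ℕ) (x : ℕ) :
    countBelow Z (x + 1) = countBelow Z x + if x ∈ Z then 1 else 0 := by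
  unfold countBelow
  split_ifs with hx
  · rw [← Finset.card_insert_of_notMem (s := Z.filter (· < x)) (a := x) (by simp)]
    congr 1
    ext y
    simp only [Finset.mem_filter, Finset.mem_insert]
    constructor
    · rintro ⟨h1, h2⟩
      by_cases hy : y = x
      · exact Or.inl hy
      · exact Or.inr ⟨h1, by omega⟩
    · rintro (rfl | ⟨h1, h2⟩)
      · exact ⟨hx, by omega⟩
      · exact ⟨h1, by omega⟩
  · rw [add_zero]
    congr 1
    ext y
    simp only [Finset.mem_filter]
    constructor
    · rintro ⟨h1, h2⟩
      refine ⟨h1, lt_of_le_of_ne (by omega) ?_⟩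
      rintro rfl
      exact hx h1
    · rintro ⟨h1, h2⟩
      exact ⟨h1, by omega⟩

theorem countBelow_mono (Z : Finset ℕ) {x y : ℕ} (hxy : x ≤ y) :
    countBelow Z x ≤ countBelow Z y :=
  Finset.card_le_card fun z hz => by
    simp only [Finset.mem_filter] at hz ⊢
    exact ⟨hz.1, by omega⟩

theorem countBelow_le (Z : Finset ℕ) (x : ℕ) : countBelow Z x ≤ x := by
  refine (Finset.card_le_card (t := Finset.range x) fun z hz => ?_).trans (Finset.card_range x).le
  simp only [Finset.mem_filter] at hz
  exact Finset.mem_range.2 hz.2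

theorem countBelow_eq_card {Z : Finset ℕ} {n : ℕ} (hZ : Z ⊆ Finset.range n) :
    countBelow Z n = Z.card := by
  unfold countBelow
  rw [Finset.filter_true_of_mem fun z hz => Finset.mem_range.1 (hZ hz)]

/-- The positions of the peaks `UD` of the word whose letters `D` are at the positions in `Z`. -/
def peakSet (Z : Finset ℕ) : Finset ℕ := Z.filter fun i => 0 < i ∧ i - 1 ∉ Z

theorem mem_peakSet {Z : Finset ℕ} {i : ℕ} : i ∈ peakSet Z ↔ i ∈ Z ∧ 0 < i ∧ i - 1 ∉ Z := by
  simp [peakSet]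

namespace Admissible

variable {p q : ℕ} {s : ℕ → ℕ}

theorem mem_matchedPositions {x : ℕ} :
    x ∈ matchedPositions p q s ↔ ∃ r < q, GreedyMatched p q s r ∧ s r + r = x := by
  simp [matchedPositions, and_assoc]

theorem add_mem_matchedPositions (h : Admissible p q s) {r : ℕ} (hr : r < q) :
    s r + r ∈ matchedPositions p q s ↔ GreedyMatched p q s r := by
  rw [mem_matchedPositions]
  constructor
  · rintro ⟨i, hi, hm, he⟩
    rwa [← h.add_inj hi hr he]
  · exact fun hm => ⟨r, hr, hm, rfl⟩

theorem matchedPositions_subset (h : Admissible p q s) :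
    matchedPositions p q s ⊆ Finset.range (p + q) := by
  intro x hx
  obtain ⟨r, hr, -, rfl⟩ := mem_matchedPositions.1 hx
  exact Finset.mem_range.2 (h.add_lt hr)

theorem exists_index (h : Admissible p q s) (x : ℕ) :
    ∃ r ≤ q, (∀ i < q, s i + i < x ↔ i < r) := by
  refine ⟨((Finset.range q).filter fun i => s i + i < x).card, ?_, ?_⟩
  · exact (Finset.card_filter_le _ _).trans (Finset.card_range q).le
  · intro i hi
    constructor
    · intro hx
      have : Finset.range (i + 1) ⊆ (Finset.range q).filter fun i => s i + i < x := by
        intro j hj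
        have hj' := Finset.mem_range.1 hj
        have := h.mono_le (Nat.le_of_lt_succ hj') hi
        simp only [Finset.mem_filter, Finset.mem_range]
        omega
      have := Finset.card_le_card this
      rw [Finset.card_range] at this
      omega
    · intro hi'
      by_contra hx
      have : ((Finset.range q).filter fun i => s i + i < x) ⊆ Finset.range i := by
        intro j hj
        simp only [Finset.mem_filter, Finset.mem_range] at hj ⊢
        exact h.lt_of_add_lt hj.1 (by omega)
      have := Finset.card_le_card this
      rw [Finset.card_range] at this
      omega

theorem countBelow_matchedPositions (h : Admissible p q s) {x r : ℕ} (hr : r ≤ q)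
    (hx : ∀ i < q, s i + i < x ↔ i < r) :
    countBelow (matchedPositions p q s) x =
      ((Finset.range r).filter (GreedyMatched p q s)).card := by
  unfold countBelow
  rw [← Finset.card_image_of_injOn (s := (Finset.range r).filter (GreedyMatched p q s))
    (f := fun r => s r + r)]
  · congr 1
    ext y
    simp only [Finset.mem_filter, mem_matchedPositions, Finset.mem_image, Finset.mem_range]
    constructor
    · rintro ⟨⟨i, hi, hm, rfl⟩, hy⟩
      exact ⟨i, ⟨(hx i hi).1 hy, hm⟩, rfl⟩
    · rintro ⟨i, ⟨hi, hm⟩, rfl⟩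
      exact ⟨⟨i, by omega, hm, rfl⟩, (hx i (by omega)).2 hi⟩
  · intro i hi j hj hij
    simp only [Finset.coe_filter, Finset.mem_range, Set.mem_ofPred_eq] at hi hj
    exact h.add_inj (by omega) (by omega) hij

theorem two_mul_countBelow_le (h : Admissible p q s) (x : ℕ) :
    2 * countBelow (matchedPositions p q s) x ≤ x := by
  obtain ⟨r, hr, hx⟩ := h.exists_index x
  rw [h.countBelow_matchedPositions hr hx]
  obtain _ | r := r
  · simp
  have h1 := card_matched_le p q s (r + 1)
  have h2 := (h.level_bounds (r := r) (by omega)).2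
  have h3 := (hx r (by omega)).2 (by omega)
  have h4 := Finset.card_filter_le (Finset.range (r + 1)) (GreedyMatched p q s)
  rw [Finset.card_range] at h4
  omega

theorem two_mul_countBelow_lt (h : Admissible p q s) {x ρ : ℕ} (hρ : ρ < q)
    (hm : ¬ GreedyMatched p q s ρ) (hx : s ρ + ρ < x) :
    2 * countBelow (matchedPositions p q s) x < x := by
  obtain ⟨r, hr, hx'⟩ := h.exists_index x
  rw [h.countBelow_matchedPositions hr hx']
  have hρr := (hx' ρ hρ).1 hx
  obtain _ | r := r
  · omega
  have h1 := card_matched_le p q s (r + 1)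
  have h2 := (h.level_bounds (r := r) (by omega)).2
  have h3 := (hx' r (by omega)).2 (by omega)
  have h4 : ((Finset.range (r + 1)).filter (GreedyMatched p q s)).card <
      (Finset.range (r + 1)).card := by
    refine Finset.card_lt_card (Finset.filter_ssubset.2 ⟨ρ, Finset.mem_range.2 hρr, hm⟩)
  rw [Finset.card_range] at h4
  omega

theorem peakSet_matchedPositions (h : Admissible p q s) :
    peakSet (matchedPositions p q s) = peakSet ((Finset.range q).image fun r => s r + r) := by
  ext i
  simp only [mem_peakSet, Finset.mem_image, Finset.mem_range]
  constructor
  · rintro ⟨h1, h2, h3⟩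
    obtain ⟨r, hr, hm, rfl⟩ := mem_matchedPositions.1 h1
    refine ⟨⟨r, hr, rfl⟩, h2, ?_⟩
    rintro ⟨j, hj, he⟩
    have hjr := h.lt_of_add_lt (i := j) (j := r) hj (by omega)
    obtain rfl : r = j + 1 := by
      have := h.mono_le (show j + 1 ≤ r from hjr) hr
      have := h.mono j (by omega)
      omega
    have hs : s (j + 1) = s j := by omega
    have hnm : ¬ GreedyMatched p q s j := fun hmj => h3 (mem_matchedPositions.2 ⟨j, hj, hmj, he⟩)
    rw [h.matched_iff hr, level_succ_of_not_matched hnm, hs] at hm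
    exact hnm ((h.matched_iff hj).2 hm)
  · rintro ⟨⟨r, hr, rfl⟩, h2, h3⟩
    refine ⟨(h.add_mem_matchedPositions hr).2 ?_, h2, ?_⟩
    · rw [h.matched_iff hr]
      obtain _ | r := r
      · have := h.lt_self hr
        simp only [greedyLevel]
        omega
      · have h4 := (h.level_bounds (r := r) (by omega)).2
        have h5 := h.mono r hr
        refine h4.trans_lt (lt_of_le_of_ne h5 fun he => h3 ⟨r, by omega, by omega⟩)
    · intro h4
      obtain ⟨j, hj, -, he⟩ := mem_matchedPositions.1 h4
      exact h3 ⟨j, hj, he⟩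

end Admissible

/-- The index `ρ` at which matching the first letter `D` in the greedy algorithm changes the status
of another letter `D`. -/
structure GreedyCollision (p q : ℕ) (s : ℕ → ℕ) (ρ : ℕ) : Prop where
  pos : 1 ≤ ρ
  lt : ρ + 1 < q
  eq : s ρ = ρ
  reserve_lt : ∀ r, 1 ≤ r → r ≤ ρ → p - s (q - 1 - r) < r
  lt_self : ∀ r, 1 ≤ r → r < ρ → r < s r

namespace Admissible

variable {p q : ℕ} {s : ℕ → ℕ}

theorem matched_def (p q : ℕ) (s : ℕ → ℕ) (r : ℕ) : GreedyMatched p q s r ↔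
    max (greedyLevel p q s r) (p - s (q - 1 - r)) < s r :=
  Iff.rfl

theorem level_succ (p q : ℕ) (s : ℕ → ℕ) (r : ℕ) : greedyLevel p q s (r + 1) =
    if max (greedyLevel p q s r) (p - s (q - 1 - r)) < s r then
      max (greedyLevel p q s r) (p - s (q - 1 - r)) + 1
    else greedyLevel p q s r :=
  rfl

theorem zero_matched (h : Admissible p q s) (hq : 0 < q) : GreedyMatched p q s 0 := by
  rw [h.matched_iff hq]
  have := h.lt_self hq
  simp only [greedyLevel]
  omega

theorem zero_mem (h : Admissible p q s) (hq : 0 < q) : s 0 ∈ matchedPositions p q s :=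
  (h.add_mem_matchedPositions hq).2 (h.zero_matched hq)

theorem zero_le_of_mem (h : Admissible p q s) {x : ℕ} (hx : x ∈ matchedPositions p q s) :
    s 0 ≤ x := by
  obtain ⟨r, hr, -, rfl⟩ := mem_matchedPositions.1 hx
  have := h.mono_le (Nat.zero_le r) hr
  omega

/-! Removal of the first and the last letter, both of them `U`. -/

theorem two_le_of_last_lt (h : Admissible p q s) (hl : s (q - 1) < p) {r : ℕ} (hr : r < q) :
    2 ≤ s r := by
  have h1 := h.gt 0 (by omega)
  have h2 := h.mono_le (Nat.zero_le r) hr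
  rw [Nat.sub_zero] at h1
  omega

theorem le_pred_of_last_lt (h : Admissible p q s) (hl : s (q - 1) < p) {r : ℕ} (hr : r < q) :
    s r + 1 ≤ p := by
  have := h.mono_le (Nat.le_sub_one_of_lt hr) (by omega)
  omega

theorem trimU (h : Admissible p q s) (hl : s (q - 1) < p) :
    Admissible (p - 2) q fun r => s r - 1 where
  mono r hr := Nat.sub_le_sub_right (h.mono r hr) 1
  le r hr := by
    have := h.le_pred_of_last_lt hl hr
    omega
  gt r hr := by
    have h1 := h.gt r hr
    have h2 := h.two_le_of_last_lt hl hr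
    have h3 := h.two_le_of_last_lt hl (r := q - 1 - r) (by omega)
    have h4 := h.le_pred_of_last_lt hl hr
    omega

theorem level_trimU (h : Admissible p q s) (hl : s (q - 1) < p) {r : ℕ} (hr : r ≤ q) :
    greedyLevel (p - 2) q (fun r => s r - 1) r = greedyLevel p q s r - 1 := by
  induction r with
  | zero => rfl
  | succ r ih =>
    have ih := ih (by omega)
    have h2 := h.two_le_of_last_lt hl (r := r) (by omega)
    have h3 := h.two_le_of_last_lt hl (r := q - 1 - r) (by omega)
    have h4 := h.le_pred_of_last_lt hl (r := q - 1 - r) (by omega)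
    simp only [greedyLevel, ih]
    split_ifs <;> omega

theorem matched_trimU (h : Admissible p q s) (hl : s (q - 1) < p) {r : ℕ} (hr : r < q) :
    GreedyMatched (p - 2) q (fun r => s r - 1) r ↔ GreedyMatched p q s r := by
  have h2 := h.two_le_of_last_lt hl hr
  have h3 := h.two_le_of_last_lt hl (r := q - 1 - r) (by omega)
  have h4 := h.le_pred_of_last_lt hl (r := q - 1 - r) (by omega)
  rw [GreedyMatched, GreedyMatched, h.level_trimU hl hr.le]
  omega

theorem mem_matchedPositions_trimU (h : Admissible p q s) (hl : s (q - 1) < p) {x : ℕ} :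
    x ∈ matchedPositions (p - 2) q (fun r => s r - 1) ↔ x + 1 ∈ matchedPositions p q s := by
  rw [mem_matchedPositions, mem_matchedPositions]
  refine exists_congr fun r => and_congr_right fun hr => ?_
  rw [h.matched_trimU hl hr]
  have := h.two_le_of_last_lt hl hr
  refine and_congr_right fun _ => ?_
  omega

theorem last_notMem_of_last_lt (h : Admissible p q s) (hl : s (q - 1) < p) :
    p + q - 1 ∉ matchedPositions p q s := by
  intro hx
  obtain ⟨r, hr, -, he⟩ := mem_matchedPositions.1 hx
  have := h.le_pred_of_last_lt hl hr
  omega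

theorem two_mul_countBelow_lt_of_last_lt (h : Admissible p q s) (hl : s (q - 1) < p) {x : ℕ}
    (hq : 0 < q) (hx : 0 < x) : 2 * countBelow (matchedPositions p q s) x < x := by
  obtain ⟨y, rfl⟩ : ∃ y, x = y + 1 := ⟨x - 1, by omega⟩
  have h1 := (h.trimU hl).two_mul_countBelow_le y
  suffices countBelow (matchedPositions p q s) (y + 1) ≤
      countBelow (matchedPositions (p - 2) q fun r => s r - 1) y by omega
  unfold countBelow
  rw [← Finset.card_image_of_injective (Finset.filter (· < y) _) (add_left_injective 1)]
  refine Finset.card_le_card fun z hz => ?_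
  rw [Finset.mem_filter] at hz
  have h3 := h.zero_le_of_mem hz.1
  have h4 := h.two_le_of_last_lt hl hq
  obtain ⟨w, rfl⟩ : ∃ w, z = w + 1 := ⟨z - 1, by omega⟩
  simp only [Finset.mem_image, Finset.mem_filter]
  exact ⟨w, ⟨(h.mem_matchedPositions_trimU hl).2 hz.1, by omega⟩, rfl⟩

/-! Removal of the first and the last letter `D` when the word ends in `D`. -/

theorem trimD (h : Admissible p q s) (hq : 2 ≤ q) :
    Admissible p (q - 2) fun r => s (r + 1) where
  mono r hr := h.mono (r + 1) (by omega)
  le r hr := h.le (r + 1) (by omega)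
  gt r hr := by
    have := h.gt (r + 1) (by omega)
    rwa [show q - 1 - (r + 1) = q - 2 - 1 - r + 1 by omega] at this

theorem matched_trimD_iff {r : ℕ} (hr : r + 2 < q) :
    GreedyMatched p (q - 2) (fun r => s (r + 1)) r ↔
      max (greedyLevel p (q - 2) (fun r => s (r + 1)) r) (p - s (q - 1 - (r + 1))) <
        s (r + 1) := by
  rw [GreedyMatched, show q - 1 - (r + 1) = q - 2 - 1 - r + 1 by omega]

theorem level_trimD_succ {r : ℕ} (hr : r + 2 < q) :
    greedyLevel p (q - 2) (fun r => s (r + 1)) (r + 1) =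
      if max (greedyLevel p (q - 2) (fun r => s (r + 1)) r) (p - s (q - 1 - (r + 1))) < s (r + 1)
      then max (greedyLevel p (q - 2) (fun r => s (r + 1)) r) (p - s (q - 1 - (r + 1))) + 1
      else greedyLevel p (q - 2) (fun r => s (r + 1)) r := by
  rw [greedyLevel, show q - 1 - (r + 1) = q - 2 - 1 - r + 1 by omega]

theorem level_one (h : Admissible p q s) (hq : 2 ≤ q) (hl : s (q - 1) = p) :
    greedyLevel p q s 1 = 1 := by
  rw [level_succ_of_matched (h.zero_matched (by omega)), Nat.sub_zero, hl]
  simp [greedyLevel]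

theorem level_of_no_collision (h : Admissible p q s) (hq : 2 ≤ q) (hl : s (q - 1) = p)
    (hc : ∀ ρ, ¬ GreedyCollision p q s ρ) {r : ℕ} (hr : r ≤ q - 2) :
    (∀ j < r, (GreedyMatched p (q - 2) (fun r => s (r + 1)) j ↔ GreedyMatched p q s (j + 1))) ∧
    ((greedyLevel p q s (r + 1) = r + 1 ∧
        greedyLevel p (q - 2) (fun r => s (r + 1)) r = r ∧
        ∀ j, 1 ≤ j → j ≤ r → p - s (q - 1 - j) < j ∧ j < s j) ∨
      greedyLevel p q s (r + 1) = greedyLevel p (q - 2) (fun r => s (r + 1)) r) := by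
  induction r with
  | zero =>
    refine ⟨fun j hj => absurd hj (Nat.not_lt_zero j), Or.inl ⟨h.level_one hq hl, rfl, ?_⟩⟩
    intro j h1 h2
    omega
  | succ r ih =>
    obtain ⟨ih1, ih2⟩ := ih (by omega)
    have hlt := h.lt_self (r := r + 1) (by omega)
    have hb := (h.level_bounds (r := r + 1) (by omega)).1
    have hm' := matched_trimD_iff (p := p) (s := s) (q := q) (r := r) (by omega)
    have hl' := level_trimD_succ (p := p) (s := s) (q := q) (r := r) (by omega)
    have hm := matched_def p q s (r + 1)
    have hlev := level_succ p q s (r + 1)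
    rcases ih2 with ⟨h1, h2, h3⟩ | h1
    · rw [h2] at hm' hl'
      rw [h1] at hm hlev hb
      by_cases ht : p - s (q - 1 - (r + 1)) < r + 1
      · by_cases hs : r + 1 < s (r + 1)
        · rw [if_pos (by omega)] at hl' hlev
          refine ⟨fun j hj => ?_, Or.inl ⟨by omega, by omega, fun j hj1 hj2 => ?_⟩⟩
          · rcases Nat.lt_succ_iff_lt_or_eq.1 hj with hj | rfl
            · exact ih1 j hj
            · rw [hm, hm']; omega
          · rcases Nat.le_succ_iff.1 hj2 with hj2 | rfl
            · exact h3 j hj1 hj2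
            · exact ⟨ht, hs⟩
        · exfalso
          refine hc (r + 1) ⟨by omega, by omega, by omega, fun j hj1 hj2 => ?_,
            fun j hj1 hj2 => (h3 j hj1 (by omega)).2⟩
          rcases Nat.le_succ_iff.1 hj2 with hj2 | rfl
          · exact (h3 j hj1 hj2).1
          · exact ht
      · rw [if_pos (by omega)] at hl' hlev
        refine ⟨fun j hj => ?_, Or.inr (by omega)⟩
        rcases Nat.lt_succ_iff_lt_or_eq.1 hj with hj | rfl
        · exact ih1 j hj
        · rw [hm, hm']; omega
    · rw [h1] at hm hlev
      refine ⟨fun j hj => ?_, Or.inr (hlev.trans hl'.symm)⟩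
      rcases Nat.lt_succ_iff_lt_or_eq.1 hj with hj | rfl
      · exact ih1 j hj
      · rw [hm, hm']

theorem mem_matchedPositions_trimD_of_no_collision (h : Admissible p q s) (hq : 2 ≤ q)
    (hl : s (q - 1) = p) (hc : ∀ ρ, ¬ GreedyCollision p q s ρ) {x : ℕ} :
    x ∈ matchedPositions p (q - 2) (fun r => s (r + 1)) ↔
      x + 1 ∈ matchedPositions p q s ∧ x + 1 ≠ s 0 ∧ x + 1 ≠ p + q - 1 := by
  have key := (h.level_of_no_collision hq hl hc le_rfl).1
  rw [mem_matchedPositions]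
  constructor
  · rintro ⟨j, hj, hm, rfl⟩
    have hm := (key j hj).1 hm
    have h1 := (h.add_lt_iff (i := 0) (j := j + 1) (by omega) (by omega)).2 (by omega)
    have h2 := (h.add_lt_iff (i := j + 1) (j := q - 1) (by omega) (by omega)).2 (by omega)
    refine ⟨mem_matchedPositions.2 ⟨j + 1, by omega, hm, rfl⟩, by omega, by omega⟩
  · rintro ⟨h1, h2, h3⟩
    obtain ⟨r, hr, hm, he⟩ := mem_matchedPositions.1 h1
    have hr0 : r ≠ 0 := by rintro rfl; omega
    have hr1 : r ≠ q - 1 := by rintro rfl; omega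
    obtain ⟨j, rfl⟩ : ∃ j, r = j + 1 := ⟨r - 1, by omega⟩
    exact ⟨j, by omega, (key j (by omega)).2 hm, by omega⟩

theorem level_before_collision (h : Admissible p q s) (hl : s (q - 1) = p) {ρ : ℕ}
    (hc : GreedyCollision p q s ρ) {r : ℕ} (hr : r ≤ ρ) :
    greedyLevel p q s r = r ∧ greedyLevel p (q - 2) (fun r => s (r + 1)) r = r ∧
      (∀ j < r, GreedyMatched p q s j ∧
        GreedyMatched p (q - 2) (fun r => s (r + 1)) j) := by
  have hρ := hc.lt
  induction r with
  | zero => exact ⟨rfl, rfl, fun j hj => absurd hj (Nat.not_lt_zero j)⟩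
  | succ r ih =>
    obtain ⟨h1, h2, h3⟩ := ih (by omega)
    have ht := hc.reserve_lt (r + 1) (by omega) hr
    have hm' : GreedyMatched p (q - 2) (fun r => s (r + 1)) r := by
      rw [matched_trimD_iff (by omega), h2]
      rcases hr.lt_or_eq with hr' | rfl
      · have := hc.lt_self (r + 1) (by omega) hr'
        omega
      · have := hc.eq
        omega
    have hl' := level_trimD_succ (p := p) (s := s) (q := q) (r := r) (by omega)
    rw [if_pos ((matched_trimD_iff (by omega)).1 hm'), h2] at hl'
    have hm : GreedyMatched p q s r := by
      rcases Nat.eq_zero_or_pos r with rfl | hr0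
      · exact h.zero_matched (by omega)
      · rw [h.matched_iff (by omega), h1]
        exact hc.lt_self r hr0 hr
    refine ⟨?_, by omega, fun j hj => ?_⟩
    · rw [level_succ_of_matched hm, h1]
      rcases Nat.eq_zero_or_pos r with rfl | hr0
      · rw [Nat.sub_zero, hl]; simp
      · have := hc.reserve_lt r hr0 (by omega)
        omega
    · rcases Nat.lt_succ_iff_lt_or_eq.1 hj with hj | rfl
      · exact h3 j hj
      · exact ⟨hm, hm'⟩

theorem collision_not_matched (h : Admissible p q s) (hl : s (q - 1) = p) {ρ : ℕ}
    (hc : GreedyCollision p q s ρ) : ¬ GreedyMatched p q s ρ := by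
  have hρ := hc.lt
  rw [h.matched_iff (by omega), (h.level_before_collision hl hc le_rfl).1, hc.eq]
  exact lt_irrefl _

theorem level_after_collision (h : Admissible p q s) (hl : s (q - 1) = p) {ρ : ℕ}
    (hc : GreedyCollision p q s ρ) {r : ℕ} (hr : ρ ≤ r) (hrq : r ≤ q - 2) :
    greedyLevel p q s (r + 1) = greedyLevel p (q - 2) (fun r => s (r + 1)) r := by
  induction r, hr using Nat.le_induction with
  | base =>
    rw [level_succ_of_not_matched (h.collision_not_matched hl hc),
      (h.level_before_collision hl hc le_rfl).1, (h.level_before_collision hl hc le_rfl).2.1]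
  | succ r hr ih =>
    have ih := ih (by omega)
    rw [level_trimD_succ (by omega), greedyLevel, ih]

theorem matched_after_collision (h : Admissible p q s) (hl : s (q - 1) = p) {ρ : ℕ}
    (hc : GreedyCollision p q s ρ) {r : ℕ} (hr : ρ ≤ r) (hrq : r + 2 < q) :
    GreedyMatched p (q - 2) (fun r => s (r + 1)) r ↔ GreedyMatched p q s (r + 1) := by
  rw [matched_trimD_iff hrq, GreedyMatched, h.level_after_collision hl hc hr (by omega)]

theorem collision_last_level (h : Admissible p q s) {ρ : ℕ}
    (hc : GreedyCollision p q s ρ) {i : ℕ} (hi : i < ρ) :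
    p - (ρ - i) + 1 ≤ greedyLevel p q s (q - (ρ - i)) := by
  have hρ := hc.lt
  have hp := h.le ρ (by omega)
  have hρe := hc.eq
  induction i with
  | zero =>
    have := h.lt_level_succ (r := q - 1 - ρ) (by omega)
    rw [show q - 1 - (q - 1 - ρ) = ρ by omega, hc.eq, show q - 1 - ρ + 1 = q - ρ by omega] at this
    rw [Nat.sub_zero]
    exact this
  | succ i ih =>
    have ih := ih (by omega)
    have h1 := h.min_le_level_succ (r := q - (ρ - i)) (by omega)
    rw [show q - (ρ - i) + 1 = q - (ρ - (i + 1)) by omega] at h1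
    have h2 := hc.reserve_lt (ρ - (i + 1)) (by omega) (by omega)
    rw [show q - 1 - (ρ - (i + 1)) = q - (ρ - i) by omega] at h2
    omega

theorem last_not_matched_of_collision (h : Admissible p q s) (hl : s (q - 1) = p) {ρ : ℕ}
    (hc : GreedyCollision p q s ρ) : ¬ GreedyMatched p q s (q - 1) := by
  have hρ := hc.lt
  have h0 := hc.pos
  have h1 := h.collision_last_level hc (i := ρ - 1) (by omega)
  rw [show ρ - (ρ - 1) = 1 by omega] at h1
  have hp := h.le ρ (by omega)
  have hρe := hc.eq
  rw [h.matched_iff (by omega), hl]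
  omega

theorem mem_matchedPositions_trimD_of_collision (h : Admissible p q s)
    (hl : s (q - 1) = p) {ρ : ℕ} (hc : GreedyCollision p q s ρ) {x : ℕ} :
    x ∈ matchedPositions p (q - 2) (fun r => s (r + 1)) ↔
      (x + 1 ∈ matchedPositions p q s ∧ x + 1 ≠ s 0) ∨ x + 1 = 2 * ρ := by
  have hρ := hc.lt
  have h0 := hc.pos
  have hρe := hc.eq
  rw [mem_matchedPositions]
  constructor
  · rintro ⟨j, hj, hm, rfl⟩
    by_cases hjρ : j + 1 = ρ
    · right; rw [hjρ, hρe]; omega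
    · left
      have h1 := (h.add_lt_iff (i := 0) (j := j + 1) (by omega) (by omega)).2 (by omega)
      refine ⟨mem_matchedPositions.2 ⟨j + 1, by omega, ?_, rfl⟩, by omega⟩
      rcases lt_or_ge j ρ with hj' | hj'
      · exact ((h.level_before_collision hl hc le_rfl).2.2 (j + 1) (by omega)).1
      · exact (h.matched_after_collision hl hc hj' (by omega)).1 hm
  · rintro (⟨h1, h2⟩ | h1)
    · obtain ⟨r, hr, hm, he⟩ := mem_matchedPositions.1 h1
      have hr0 : r ≠ 0 := by rintro rfl; omega
      have hr1 : r ≠ q - 1 := by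
        rintro rfl
        exact h.last_not_matched_of_collision hl hc hm
      obtain ⟨j, rfl⟩ : ∃ j, r = j + 1 := ⟨r - 1, by omega⟩
      refine ⟨j, by omega, ?_, by omega⟩
      rcases lt_or_ge j ρ with hj' | hj'
      · exact ((h.level_before_collision hl hc le_rfl).2.2 j hj').2
      · exact (h.matched_after_collision hl hc hj' (by omega)).2 hm
    · refine ⟨ρ - 1, by omega,
        ((h.level_before_collision hl hc le_rfl).2.2 (ρ - 1) (by omega)).2, ?_⟩
      rw [show ρ - 1 + 1 = ρ by omega, hρe]
      omega

theorem countBelow_collision (h : Admissible p q s) (hl : s (q - 1) = p) {ρ : ℕ}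
    (hc : GreedyCollision p q s ρ) : countBelow (matchedPositions p q s) (2 * ρ) = ρ := by
  have hρ := hc.lt
  have hρe := hc.eq
  rw [h.countBelow_matchedPositions (r := ρ) (by omega) fun i hi => by
    rw [← h.add_lt_iff hi (j := ρ) (by omega)]; omega]
  rw [Finset.filter_true_of_mem, Finset.card_range]
  exact fun j hj => ((h.level_before_collision hl hc le_rfl).2.2 j (Finset.mem_range.1 hj)).1

theorem two_mul_countBelow_lt_of_collision (h : Admissible p q s) (hl : s (q - 1) = p) {ρ : ℕ}
    (hc : GreedyCollision p q s ρ) {x : ℕ} (hx : 2 * ρ < x) :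
    2 * countBelow (matchedPositions p q s) x < x := by
  have hρ := hc.lt
  have hρe := hc.eq
  exact h.two_mul_countBelow_lt (by omega) (h.collision_not_matched hl hc) (by omega)

theorem two_mul_lt_last_of_collision {ρ : ℕ} (h : Admissible p q s)
    (hc : GreedyCollision p q s ρ) : 2 * ρ < p + q - 1 := by
  have hρ := hc.lt
  have hρe := hc.eq
  have := h.le ρ (by omega)
  omega

theorem lt_self_of_no_collision (h : Admissible p q s) (hc : ∀ ρ, ¬ GreedyCollision p q s ρ)
    {i : ℕ} (hi : i + 1 < q) (ht : ∀ j, 1 ≤ j → j ≤ i → p - s (q - 1 - j) < j) :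
    ∀ j, 1 ≤ j → j ≤ i → j < s j := by
  intro j
  induction j using Nat.strong_induction_on with
  | _ j ih =>
    intro h1 h2
    by_contra hj
    refine hc j ⟨h1, by omega, le_antisymm (not_lt.1 hj) ?_, fun r hr1 hr2 => ht r hr1 (by omega),
      fun r hr1 hr2 => ih r hr2 hr1 (by omega)⟩
    have h3 := h.mono (j - 1) (by omega)
    rw [show j - 1 + 1 = j by omega] at h3
    rcases Nat.lt_or_ge 1 j with hj1 | hj1
    · have := ih (j - 1) (by omega) (by omega) (by omega)
      omega
    · have h4 := h.lt_self (r := 0) (by omega)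
      obtain rfl : j = 1 := by omega
      rw [show 1 - 1 = 0 from rfl] at h3
      omega

theorem level_add_of_last_not_matched (h : Admissible p q s) (hl : s (q - 1) = p)
    (hc : ∀ ρ, ¬ GreedyCollision p q s ρ) (hm : ¬ GreedyMatched p q s (q - 1)) {i : ℕ}
    (hi1 : 1 ≤ i) (hi2 : i < q) :
    ∀ j, 1 ≤ j → j ≤ i → p + 1 ≤ greedyLevel p q s (q - j) + j := by
  induction i, hi1 using Nat.le_induction with
  | base =>
    intro j hj1 hj2
    obtain rfl : j = 1 := by omega
    rw [h.matched_iff (by omega), hl] at hm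
    omega
  | succ i hi1 ih =>
    have ih := ih (by omega)
    intro j hj1 hj2
    rcases Nat.le_succ_iff.1 hj2 with hj2 | rfl
    · exact ih j hj1 hj2
    change p + 1 ≤ greedyLevel p q s (q - (i + 1)) + (i + 1)
    have ht : ∀ j, 1 ≤ j → j ≤ i → p - s (q - 1 - j) < j := by
      intro j hj1 hj2
      have h1 := ih j hj1 hj2
      have h2 := (h.level_bounds (r := q - 1 - j) (by omega)).2
      rw [show q - 1 - j + 1 = q - j by omega] at h2
      omega
    have hs := h.lt_self_of_no_collision hc hi2 ht i hi1 le_rfl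
    have h1 := ih i hi1 le_rfl
    have h2 := level_succ_le p q s (q - (i + 1))
    rw [show q - (i + 1) + 1 = q - i by omega, show q - 1 - (q - (i + 1)) = i by omega] at h2
    omega

theorem countBelow_last_of_no_collision (h : Admissible p q s) (hq : 2 ≤ q) (hl : s (q - 1) = p)
    (hc : ∀ ρ, ¬ GreedyCollision p q s ρ) (hm : ¬ GreedyMatched p q s (q - 1)) :
    2 * countBelow (matchedPositions p q s) (p + q - 1) = p + q - 1 := by
  have h1 := h.level_add_of_last_not_matched hl hc hm (i := q - 1) (by omega) (by omega)
  have ht : ∀ j, 1 ≤ j → j ≤ q - 1 → p - s (q - 1 - j) < j := by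
    intro j hj1 hj2
    have h1 := h1 j hj1 hj2
    have h2 := (h.level_bounds (r := q - 1 - j) (by omega)).2
    rw [show q - 1 - j + 1 = q - j by omega] at h2
    omega
  have hs := h.lt_self_of_no_collision hc (i := q - 2) (by omega)
    fun j hj1 hj2 => ht j hj1 (by omega)
  have hlev : ∀ r ≤ q - 1, greedyLevel p q s r = r ∧ ∀ j < r, GreedyMatched p q s j := by
    intro r hr
    induction r with
    | zero => exact ⟨rfl, fun j hj => absurd hj (Nat.not_lt_zero j)⟩
    | succ r ih =>
      obtain ⟨ih1, ih2⟩ := ih (by omega)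
      rcases Nat.eq_zero_or_pos r with rfl | hr0
      · refine ⟨h.level_one hq hl, fun j hj => ?_⟩
        obtain rfl : j = 0 := by omega
        exact h.zero_matched (by omega)
      · have hmr : GreedyMatched p q s r := by
          rw [h.matched_iff (by omega), ih1]
          exact hs r hr0 (by omega)
        have := ht r hr0 (by omega)
        refine ⟨by rw [level_succ_of_matched hmr, ih1]; omega, fun j hj => ?_⟩
        rcases Nat.lt_succ_iff_lt_or_eq.1 hj with hj | rfl
        · exact ih2 j hj
        · exact hmr
  have h2 := h1 (q - 1) (by omega) le_rfl
  rw [show q - (q - 1) = 1 by omega, h.level_one hq hl] at h2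
  have h3 := (h.level_bounds (r := q - 1) (by omega)).1
  rw [(hlev _ le_rfl).1, hl] at h3
  rw [h.countBelow_matchedPositions (r := q - 1) (by omega) fun i hi => by
    rw [← h.add_lt_iff hi (j := q - 1) (by omega)]; omega]
  rw [Finset.filter_true_of_mem fun j hj => (hlev _ le_rfl).2 j (Finset.mem_range.1 hj),
    Finset.card_range]
  omega

end Admissible

namespace Admissible

variable {p q p' q' : ℕ} {s s' : ℕ → ℕ}

theorem matchedPositions_eq_empty_iff (h : Admissible p q s) :
    matchedPositions p q s = ∅ ↔ q = 0 := by
  constructor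
  · intro he
    by_contra hq
    have := h.zero_mem (by omega)
    simp [he] at this
  · rintro rfl
    simp [matchedPositions]

theorem zero_eq_of_matchedPositions_eq (h : Admissible p q s) (h' : Admissible p' q' s')
    (hq : 0 < q) (hq' : 0 < q') (hZ : matchedPositions p q s = matchedPositions p' q' s') :
    s 0 = s' 0 :=
  le_antisymm (h.zero_le_of_mem (hZ ▸ h'.zero_mem hq')) (h'.zero_le_of_mem (hZ ▸ h.zero_mem hq))

theorem last_matched_iff (h : Admissible p q s) (hq : 0 < q) (hl : s (q - 1) = p) :
    GreedyMatched p q s (q - 1) ↔ p + q - 1 ∈ matchedPositions p q s := by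
  rw [← h.add_mem_matchedPositions (by omega), hl, Nat.add_sub_assoc hq]

/-- A word that ends in `D` is told from a word that ends in `U` by its matched letters. -/
theorem not_last_lt_of_last_eq (h : Admissible p q s) (h' : Admissible p' q' s')
    (hN : p + q = p' + q') (hq : 0 < q) (hq' : 0 < q')
    (hZ : matchedPositions p q s = matchedPositions p' q' s') (hl : s (q - 1) = p) :
    s' (q' - 1) = p' := by
  by_contra hne
  have hlt : s' (q' - 1) < p' := lt_of_le_of_ne (h'.le _ (by omega)) hne
  have h1 := h'.last_notMem_of_last_lt hlt
  rw [← hN, ← hZ, ← h.last_matched_iff hq hl] at h1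
  have hq2 : 2 ≤ q := by
    by_contra hq2
    obtain rfl : q = 1 := by omega
    exact h1 (h.zero_matched hq)
  by_cases hc : ∀ ρ, ¬ GreedyCollision p q s ρ
  · have h2 := h.countBelow_last_of_no_collision hq2 hl hc h1
    have h3 := h'.two_mul_countBelow_lt_of_last_lt hlt (x := p + q - 1) hq' (by omega)
    rw [← hZ] at h3
    omega
  · push Not at hc
    obtain ⟨ρ, hc⟩ := hc
    have h2 := h.countBelow_collision hl hc
    have h3 := h'.two_mul_countBelow_lt_of_last_lt hlt (x := 2 * ρ) hq' (by have := hc.pos; omega)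
    rw [← hZ] at h3
    omega

theorem two_le_of_last_eq (h : Admissible p q s) (h' : Admissible p' q' s')
    (hN : p + q = p' + q') (hq : 2 ≤ q) (hq' : 0 < q')
    (hZ : matchedPositions p q s = matchedPositions p' q' s') (hl' : s' (q' - 1) = p') :
    2 ≤ q' := by
  by_contra hq2
  obtain rfl : q' = 1 := by omega
  have h0 := h.zero_eq_of_matchedPositions_eq h' (by omega) hq' hZ
  have h1 := h.le 0 (by omega)
  rw [Nat.sub_self] at hl'
  omega

theorem collision_of_collision (h : Admissible p q s) (h' : Admissible p' q' s')
    (hN : p + q = p' + q') (hq : 2 ≤ q) (hq' : 2 ≤ q')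
    (hZ : matchedPositions p q s = matchedPositions p' q' s')
    (hl : s (q - 1) = p) (hl' : s' (q' - 1) = p') {ρ : ℕ} (hc : GreedyCollision p q s ρ) :
    ∃ ρ', GreedyCollision p' q' s' ρ' := by
  by_contra hc'
  push Not at hc'
  have h1 := h.last_not_matched_of_collision hl hc
  rw [h.last_matched_iff (by omega) hl, hN, hZ, ← h'.last_matched_iff (by omega) hl'] at h1
  have h2 := h'.countBelow_last_of_no_collision hq' hl' hc' h1
  have h3 := h.two_mul_countBelow_lt_of_collision hl hc (h.two_mul_lt_last_of_collision hc)
  rw [hZ, hN] at h3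
  omega

theorem collision_index_le (h : Admissible p q s) (h' : Admissible p' q' s')
    (hZ : matchedPositions p q s = matchedPositions p' q' s')
    (hl : s (q - 1) = p) (hl' : s' (q' - 1) = p') {ρ ρ' : ℕ} (hc : GreedyCollision p q s ρ)
    (hc' : GreedyCollision p' q' s' ρ') : ρ' ≤ ρ := by
  by_contra hlt
  have h1 := h.two_mul_countBelow_lt_of_collision hl hc (x := 2 * ρ') (by omega)
  have h2 := h'.countBelow_collision hl' hc'
  rw [hZ] at h1
  omega

theorem matchedPositions_trimD_eq (h : Admissible p q s) (h' : Admissible p' q' s')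
    (hN : p + q = p' + q') (hq : 2 ≤ q) (hq' : 2 ≤ q')
    (hZ : matchedPositions p q s = matchedPositions p' q' s')
    (hl : s (q - 1) = p) (hl' : s' (q' - 1) = p') :
    matchedPositions p (q - 2) (fun r => s (r + 1)) =
      matchedPositions p' (q' - 2) (fun r => s' (r + 1)) := by
  have h0 := h.zero_eq_of_matchedPositions_eq h' (by omega) (by omega) hZ
  ext x
  by_cases hc : ∃ ρ, GreedyCollision p q s ρ
  · obtain ⟨ρ, hc⟩ := hc
    obtain ⟨ρ', hc'⟩ := h.collision_of_collision h' hN hq hq' hZ hl hl' hc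
    have h1 := h.collision_index_le h' hZ hl hl' hc hc'
    have h2 := h'.collision_index_le h hZ.symm hl' hl hc' hc
    rw [h.mem_matchedPositions_trimD_of_collision hl hc,
      h'.mem_matchedPositions_trimD_of_collision hl' hc', hZ, h0, le_antisymm h1 h2]
  · have hc' : ∀ ρ, ¬ GreedyCollision p' q' s' ρ := fun ρ hρ =>
      hc (h'.collision_of_collision h hN.symm hq' hq hZ.symm hl' hl hρ)
    push Not at hc
    rw [h.mem_matchedPositions_trimD_of_no_collision hq hl hc,
      h'.mem_matchedPositions_trimD_of_no_collision hq' hl' hc', hZ, h0, hN]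

theorem eq_of_matchedPositions_eq (h : Admissible p q s) (h' : Admissible p' q' s')
    (hN : p + q = p' + q') (hZ : matchedPositions p q s = matchedPositions p' q' s') :
    q = q' ∧ ∀ r < q, s r = s' r := by
  induction hn : p + q using Nat.strong_induction_on generalizing p q p' q' s s' with
  | _ n ih =>
    rcases Nat.eq_zero_or_pos q with rfl | hq
    · refine ⟨?_, fun r hr => absurd hr (Nat.not_lt_zero r)⟩
      rw [eq_comm, ← h'.matchedPositions_eq_empty_iff, ← hZ, h.matchedPositions_eq_empty_iff]
    have hq' : 0 < q' := by
      rw [Nat.pos_iff_ne_zero, Ne, ← h'.matchedPositions_eq_empty_iff, ← hZ,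
        h.matchedPositions_eq_empty_iff]
      omega
    have h0 := h.zero_eq_of_matchedPositions_eq h' hq hq' hZ
    by_cases hl : s (q - 1) = p
    · have hl' := h.not_last_lt_of_last_eq h' hN hq hq' hZ hl
      rcases Nat.lt_or_ge q 2 with hq2 | hq2
      · have hq2' : q' < 2 := by
          by_contra hc
          have := h'.two_le_of_last_eq h hN.symm (by omega) hq hZ.symm hl
          omega
        refine ⟨by omega, fun r hr => ?_⟩
        obtain rfl : r = 0 := by omega
        exact h0
      · have hq2' := h.two_le_of_last_eq h' hN hq2 hq' hZ hl'
        obtain ⟨h1, h2⟩ := ih (p + (q - 2)) (by omega) (h.trimD hq2) (h'.trimD hq2') (by omega)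
          (h.matchedPositions_trimD_eq h' hN hq2 hq2' hZ hl hl') rfl
        obtain rfl : q = q' := by omega
        refine ⟨rfl, fun r hr => ?_⟩
        rcases Nat.eq_zero_or_pos r with rfl | hr0
        · exact h0
        · by_cases hrl : r = q - 1
          · rw [hrl, hl, hl']; omega
          · have := h2 (r - 1) (by omega)
            rwa [show r - 1 + 1 = r by omega] at this
    · have hl' : s' (q' - 1) ≠ p' := fun hl' =>
        hl (h'.not_last_lt_of_last_eq h hN.symm hq' hq hZ.symm hl')
      have hlt := lt_of_le_of_ne (h.le (q - 1) (by omega)) hl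
      have hlt' := lt_of_le_of_ne (h'.le (q' - 1) (by omega)) hl'
      have hp := h.two_le_of_last_lt hlt (r := q - 1) (by omega)
      have hp' := h'.two_le_of_last_lt hlt' (r := q' - 1) (by omega)
      obtain ⟨h1, h2⟩ := ih (p - 2 + q) (by omega) (h.trimU hlt) (h'.trimU hlt') (by omega)
        (by ext x; rw [h.mem_matchedPositions_trimU hlt, h'.mem_matchedPositions_trimU hlt', hZ])
        rfl
      refine ⟨h1, fun r hr => ?_⟩
      have h3 := h2 r hr
      have h4 := h.two_le_of_last_lt hlt hr
      have h5 := h'.two_le_of_last_lt hlt' (r := r) (by omega)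
      omega

end Admissible

/-- The words whose letters `D`, listed as `d₀ < … < d_{q-1}`, satisfy `n ≤ d_r + d_{q-1-r}`. -/
structure ReverseAdmissible (n : ℕ) (D : Finset ℕ) : Prop where
  subset : D ⊆ Finset.range n
  le_add : ∀ j ∈ D, ∀ k ∈ D, countBelow D j + countBelow D k + 1 = D.card → n ≤ j + k

/-- The number of letters `U` before the `r`-th letter `D`. -/
noncomputable def gapSequence (D : Finset ℕ) (r : ℕ) : ℕ := Nat.nth (· ∈ D) r - r

theorem countBelow_eq_count (D : Finset ℕ) (x : ℕ) : countBelow D x = Nat.count (· ∈ D) x := by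
  rw [Nat.count_eq_card_filter_range, countBelow]
  congr 1
  ext y
  simp [and_comm]

section gapSequence

variable (D : Finset ℕ)

theorem finite_setOf_mem : {x | x ∈ D}.Finite := D.finite_toSet

theorem card_finite_setOf_mem : (finite_setOf_mem D).toFinset.card = D.card := by
  congr 1
  ext x
  simp

variable {D}

theorem nth_mem_finset {r : ℕ} (hr : r < D.card) : Nat.nth (· ∈ D) r ∈ D :=
  Nat.nth_mem_of_lt_card (finite_setOf_mem D) (by rwa [card_finite_setOf_mem])

theorem countBelow_nth {r : ℕ} (hr : r < D.card) : countBelow D (Nat.nth (· ∈ D) r) = r := by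
  rw [countBelow_eq_count]
  exact Nat.count_nth fun hf => hr.trans_eq (by rw [← card_finite_setOf_mem])

theorem nth_countBelow {x : ℕ} (hx : x ∈ D) : Nat.nth (· ∈ D) (countBelow D x) = x := by
  rw [countBelow_eq_count]
  exact Nat.nth_count hx

theorem countBelow_lt_card {x : ℕ} (hx : x ∈ D) : countBelow D x < D.card := by
  refine Finset.card_lt_card (Finset.filter_ssubset.2 ⟨x, hx, lt_irrefl x⟩)

theorem gapSequence_add {r : ℕ} (hr : r < D.card) :
    gapSequence D r + r = Nat.nth (· ∈ D) r := by
  have := countBelow_le D (Nat.nth (· ∈ D) r)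
  rw [countBelow_nth hr] at this
  exact Nat.sub_add_cancel this

theorem image_gapSequence (D : Finset ℕ) :
    ((Finset.range D.card).image fun r => gapSequence D r + r) = D := by
  ext x
  simp only [Finset.mem_image, Finset.mem_range]
  constructor
  · rintro ⟨r, hr, rfl⟩
    rw [gapSequence_add hr]
    exact nth_mem_finset hr
  · intro hx
    have hr := countBelow_lt_card hx
    exact ⟨countBelow D x, hr, by rw [gapSequence_add hr, nth_countBelow hx]⟩

theorem nth_lt_nth_finset {i j : ℕ} (hij : i < j) (hj : j < D.card) :
    Nat.nth (· ∈ D) i < Nat.nth (· ∈ D) j :=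
  Nat.nth_lt_nth' hij fun _ => hj.trans_eq (by rw [← card_finite_setOf_mem])

end gapSequence

theorem ReverseAdmissible.card_le {n : ℕ} {D : Finset ℕ} (h : ReverseAdmissible n D) :
    D.card ≤ n :=
  (Finset.card_le_card h.subset).trans (Finset.card_range n).le

theorem ReverseAdmissible.admissible {n : ℕ} {D : Finset ℕ} (h : ReverseAdmissible n D) :
    Admissible (n - D.card) D.card (gapSequence D) := by
  have hmono : ∀ r, r + 1 < D.card → gapSequence D r ≤ gapSequence D (r + 1) := by
    intro r hr
    have h1 := gapSequence_add (D := D) (r := r) (by omega)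
    have h2 := gapSequence_add hr
    have h3 := nth_lt_nth_finset (Nat.lt_succ_self r) hr
    rw [Nat.succ_eq_add_one] at h3
    omega
  have hle : ∀ r k, r + k < D.card → gapSequence D r ≤ gapSequence D (r + k) := by
    intro r k
    induction k with
    | zero => exact fun _ => le_rfl
    | succ k ih => exact fun hk => (ih (by omega)).trans (hmono _ hk)
  refine ⟨hmono, fun r hr => ?_, fun r hr => ?_⟩
  · have h1 := hle r (D.card - 1 - r) (by omega)
    rw [show r + (D.card - 1 - r) = D.card - 1 by omega] at h1
    have h2 := gapSequence_add (D := D) (r := D.card - 1) (by omega)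
    have h3 := Finset.mem_range.1 (h.subset (nth_mem_finset (D := D) (r := D.card - 1) (by omega)))
    omega
  · have hr' : D.card - 1 - r < D.card := by omega
    have h1 := gapSequence_add hr
    have h2 := gapSequence_add hr'
    have h3 := h.le_add _ (nth_mem_finset hr) _ (nth_mem_finset hr')
      (by rw [countBelow_nth hr, countBelow_nth hr']; omega)
    have h4 := h.card_le
    omega

/-- The ballot word of a reverse admissible word: the unmatched letters `D` become `U`. -/
noncomputable def ballotOf (n : ℕ) (D : Finset ℕ) : Finset ℕ :=
  matchedPositions (n - D.card) D.card (gapSequence D)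

/-- The words of length `n` all of whose prefixes have at least as many letters `U` as letters `D`,
the set being that of the positions of the letters `D`. -/
structure IsBallot (n : ℕ) (Z : Finset ℕ) : Prop where
  subset : Z ⊆ Finset.range n
  le : ∀ x, 2 * countBelow Z x ≤ x

namespace ReverseAdmissible

variable {n : ℕ} {D E : Finset ℕ}

theorem isBallot_ballotOf (h : ReverseAdmissible n D) : IsBallot n (ballotOf n D) where
  subset := by
    have := h.admissible.matchedPositions_subset
    rwa [Nat.sub_add_cancel h.card_le] at this
  le := h.admissible.two_mul_countBelow_le

theorem peakSet_ballotOf (h : ReverseAdmissible n D) : peakSet (ballotOf n D) = peakSet D := by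
  rw [ballotOf, h.admissible.peakSet_matchedPositions, image_gapSequence]

theorem eq_of_ballotOf_eq (hD : ReverseAdmissible n D) (hE : ReverseAdmissible n E)
    (h : ballotOf n D = ballotOf n E) : D = E := by
  have h1 := hD.card_le
  have h2 := hE.card_le
  obtain ⟨h3, h4⟩ := hD.admissible.eq_of_matchedPositions_eq hE.admissible (by omega) h
  rw [← image_gapSequence D, ← image_gapSequence E, ← h3]
  refine Finset.image_congr fun r hr => ?_
  have := h4 r (Finset.mem_range.1 hr)
  simp only [this]

end ReverseAdmissible

/-- A ballot word read alternately from the left end and, with letters exchanged, from the right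
end. -/
def foldBallot (n : ℕ) (Z : Finset ℕ) : Finset ℕ :=
  (Finset.range n).filter fun x => if 2 * x < n then 2 * x ∈ Z else 2 * (n - 1 - x) + 1 ∉ Z

theorem mem_foldBallot_left {n : ℕ} {Z : Finset ℕ} {x : ℕ} (hx : 2 * x < n) :
    x ∈ foldBallot n Z ↔ 2 * x ∈ Z := by
  simp only [foldBallot, Finset.mem_filter, Finset.mem_range, if_pos hx, and_iff_right_iff_imp]
  omega

theorem mem_foldBallot_right {n : ℕ} {Z : Finset ℕ} {x : ℕ} (hx : 2 * x + 1 < n) :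
    n - 1 - x ∈ foldBallot n Z ↔ 2 * x + 1 ∉ Z := by
  simp only [foldBallot, Finset.mem_filter, Finset.mem_range]
  rw [if_neg (by omega), show n - 1 - (n - 1 - x) = x by omega, and_iff_right_iff_imp]
  omega

theorem foldBallot_subset (n : ℕ) (Z : Finset ℕ) : foldBallot n Z ⊆ Finset.range n :=
  Finset.filter_subset _ _

theorem countBelow_foldBallot (n : ℕ) (Z : Finset ℕ) {l : ℕ} (hl : 2 * l ≤ n) :
    countBelow Z (2 * l) + (foldBallot n Z).card =
      countBelow (foldBallot n Z) l + l + countBelow (foldBallot n Z) (n - l) := by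
  induction l with
  | zero => simp [countBelow_zero, countBelow_eq_card (foldBallot_subset n Z)]
  | succ l ih =>
    have ih := ih (by omega)
    have h1 := mem_foldBallot_left (Z := Z) (x := l) (n := n) (by omega)
    have h2 := mem_foldBallot_right (Z := Z) (x := l) (n := n) (by omega)
    have h3 := countBelow_succ (foldBallot n Z) (n - 1 - l)
    have h4 := countBelow_succ (foldBallot n Z) l
    have h5 := countBelow_succ Z (2 * l)
    have h6 := countBelow_succ Z (2 * l + 1)
    rw [show n - 1 - l + 1 = n - l by omega] at h3
    rw [show n - (l + 1) = n - 1 - l by omega, show 2 * (l + 1) = 2 * l + 1 + 1 by ring]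
    simp only [h1, h2] at h3 h4
    split_ifs at h3 h4 h5 h6 <;> omega

namespace IsBallot

variable {n : ℕ} {Z Y : Finset ℕ}

theorem reverseAdmissible_foldBallot (h : IsBallot n Z) :
    ReverseAdmissible n (foldBallot n Z) where
  subset := foldBallot_subset n Z
  le_add := by
    suffices key : ∀ j ∈ foldBallot n Z, ∀ k ∈ foldBallot n Z, j ≤ k →
        countBelow (foldBallot n Z) j + countBelow (foldBallot n Z) k + 1 = (foldBallot n Z).card →
        n ≤ j + k by
      intro j hj k hk he
      rcases le_total j k with hjk | hjk
      · exact key j hj k hk hjk he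
      · rw [add_comm]
        exact key k hk j hj hjk (by omega)
    intro j hj k hk hjk he
    by_contra hlt
    have h1 := countBelow_foldBallot n Z (l := j) (by omega)
    have h2 := countBelow_mono (foldBallot n Z) (show k + 1 ≤ n - j by omega)
    rw [countBelow_succ, if_pos hk] at h2
    have h3 := h.le (2 * j + 1)
    rw [countBelow_succ, if_pos ((mem_foldBallot_left (by omega)).1 hj)] at h3
    omega

theorem eq_of_foldBallot_eq (hZ : IsBallot n Z) (hY : IsBallot n Y)
    (h : foldBallot n Z = foldBallot n Y) : Z = Y := by
  ext x
  by_cases hx : x < n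
  · obtain ⟨i, rfl | rfl⟩ := Nat.even_or_odd' x
    · rw [← mem_foldBallot_left hx, h, mem_foldBallot_left hx]
    · rw [← not_iff_not, ← mem_foldBallot_right hx, h, mem_foldBallot_right hx]
  · constructor
    · exact fun h1 => absurd (Finset.mem_range.1 (hZ.subset h1)) hx
    · exact fun h1 => absurd (Finset.mem_range.1 (hY.subset h1)) hx

end IsBallot

section Reversal

variable {n : ℕ} {π σ : Equiv.Perm (Fin n)} {A : Finset (Fin n)}

/-- A decreasing involution of a set exchanges the numbers of elements below and above. -/
theorem card_filter_lt_eq_of_strictAntiOn (hinv : ∀ x, π (π x) = x) (hA : ∀ x ∈ A, π x ∈ A)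
    (hanti : StrictAntiOn π A) {j : Fin n} (hj : j ∈ A) :
    (A.filter (· < j)).card = (A.filter (π j < ·)).card := by
  rw [← Finset.card_map π.toEmbedding]
  congr 1
  ext x
  simp only [Finset.mem_map, Finset.mem_filter, Equiv.coe_toEmbedding]
  constructor
  · rintro ⟨y, ⟨h1, h2⟩, rfl⟩
    exact ⟨hA y h1, hanti h1 hj h2⟩
  · rintro ⟨h1, h2⟩
    refine ⟨π x, ⟨hA x h1, ?_⟩, hinv x⟩
    have := hanti (hA j hj) h1 h2
    rwa [hinv] at this

theorem card_filter_gt_inj {x y : Fin n} (hx : x ∈ A) (hy : y ∈ A)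
    (h : (A.filter (x < ·)).card = (A.filter (y < ·)).card) : x = y := by
  by_contra hne
  wlog hlt : x < y generalizing x y
  · exact this hy hx h.symm (Ne.symm hne) (lt_of_le_of_ne (not_lt.1 hlt) (Ne.symm hne))
  refine absurd h (ne_of_gt (Finset.card_lt_card ?_))
  refine Finset.ssubset_iff_of_subset (fun z hz => ?_) |>.2 ⟨y, ?_, ?_⟩
  · rw [Finset.mem_filter] at hz ⊢
    exact ⟨hz.1, hlt.trans hz.2⟩
  · exact Finset.mem_filter.2 ⟨hy, hlt⟩
  · simp

theorem eqOn_of_strictAntiOn (hπ : ∀ x, π (π x) = x) (hσ : ∀ x, σ (σ x) = x)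
    (hπA : ∀ x ∈ A, π x ∈ A) (hσA : ∀ x ∈ A, σ x ∈ A) (hπ' : StrictAntiOn π A)
    (hσ' : StrictAntiOn σ A) : ∀ x ∈ A, π x = σ x := fun x hx =>
  card_filter_gt_inj (hπA x hx) (hσA x hx)
    ((card_filter_lt_eq_of_strictAntiOn hπ hπA hπ' hx).symm.trans
      (card_filter_lt_eq_of_strictAntiOn hσ hσA hσ' hx))

end Reversal

/-- The elements that are not left-to-right minima of a permutation. -/
def nonMinima {n : ℕ} (π : Equiv.Perm (Fin n)) : Finset (Fin n) :=
  Finset.univ.filter fun j => ∃ i, i < j ∧ π i < π j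

theorem mem_nonMinima {n : ℕ} {π : Equiv.Perm (Fin n)} {j : Fin n} :
    j ∈ nonMinima π ↔ ∃ i, i < j ∧ π i < π j := by
  simp [nonMinima]

/-- The set of positions (counted from `0`) of the elements that are not left-to-right minima. -/
def nonMinimaPositions {n : ℕ} (π : Equiv.Perm (Fin n)) : Finset ℕ :=
  (nonMinima π).map Fin.valEmbedding

theorem coe_mem_nonMinimaPositions {n : ℕ} {π : Equiv.Perm (Fin n)} {j : Fin n} :
    (j : ℕ) ∈ nonMinimaPositions π ↔ j ∈ nonMinima π := by
  simp [nonMinimaPositions, Fin.val_inj]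

theorem nonMinimaPositions_subset {n : ℕ} (π : Equiv.Perm (Fin n)) :
    nonMinimaPositions π ⊆ Finset.range n := by
  intro x hx
  obtain ⟨j, -, rfl⟩ := Finset.mem_map.1 hx
  exact Finset.mem_range.2 j.2

theorem countBelow_map_val {n : ℕ} (A : Finset (Fin n)) (j : Fin n) :
    countBelow (A.map Fin.valEmbedding) j = (A.filter (· < j)).card := by
  rw [← Finset.card_map Fin.valEmbedding, countBelow]
  congr 1
  ext x
  simp only [Finset.mem_map, Finset.mem_filter]
  constructor
  · rintro ⟨⟨y, hy, rfl⟩, hlt⟩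
    exact ⟨y, ⟨hy, hlt⟩, rfl⟩
  · rintro ⟨y, ⟨hy, hlt⟩, rfl⟩
    exact ⟨⟨y, hy, rfl⟩, hlt⟩

theorem card_filter_lt_add_card_filter_gt {n : ℕ} {A : Finset (Fin n)} {j : Fin n} (hj : j ∈ A) :
    (A.filter (· < j)).card + (A.filter (j < ·)).card + 1 = A.card := by
  rw [← Finset.card_union_of_disjoint, ← Finset.card_insert_of_notMem (a := j)]
  · congr 1
    ext x
    simp only [Finset.mem_insert, Finset.mem_union, Finset.mem_filter, ← and_or_left]
    constructor
    · rintro (rfl | h)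
      exacts [hj, h.1]
    · intro h
      rcases eq_or_ne x j with h1 | h1
      · exact Or.inl h1
      · exact Or.inr ⟨h, lt_or_gt_of_ne h1⟩
  · simp
  · rw [Finset.disjoint_left]
    intro x h1 h2
    exact lt_asymm (Finset.mem_filter.1 h1).2 (Finset.mem_filter.1 h2).2

theorem mem_involutions123 {n : ℕ} {π : Equiv.Perm (Fin n)} :
    π ∈ involutions123 n ↔ (∀ x, π (π x) = x) ∧ Avoids123 π := by
  refine and_congr_left fun _ => ?_
  rw [eq_inv_iff_mul_eq_one, Equiv.ext_iff]
  rfl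

section Involution

variable {n : ℕ} {π σ : Equiv.Perm (Fin n)}

theorem apply_mem_nonMinima (hinv : ∀ x, π (π x) = x) {j : Fin n} (hj : j ∈ nonMinima π) :
    π j ∈ nonMinima π := by
  obtain ⟨i, h1, h2⟩ := mem_nonMinima.1 hj
  exact mem_nonMinima.2 ⟨π i, h2, by rwa [hinv, hinv]⟩

theorem apply_mem_compl_nonMinima (hinv : ∀ x, π (π x) = x) {j : Fin n}
    (hj : j ∈ (nonMinima π)ᶜ) : π j ∈ (nonMinima π)ᶜ := by
  rw [Finset.mem_compl] at hj ⊢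
  intro h
  have := apply_mem_nonMinima hinv h
  rw [hinv] at this
  exact hj this

theorem strictAntiOn_nonMinima (h : Avoids123 π) : StrictAntiOn π (nonMinima π) := by
  intro j hj k hk hjk
  obtain ⟨i, h1, h2⟩ := mem_nonMinima.1 (Finset.mem_coe.1 hj)
  refine lt_of_le_of_ne (not_lt.1 fun hlt => h ⟨i, j, k, h1, hjk, h2, hlt⟩) fun he => ?_
  exact hjk.ne' (π.injective he)

theorem strictAntiOn_compl_nonMinima (π : Equiv.Perm (Fin n)) :
    StrictAntiOn π ((nonMinima π)ᶜ : Finset (Fin n)) := by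
  intro j _ k hk hjk
  rw [Finset.mem_coe, Finset.mem_compl, mem_nonMinima] at hk
  exact lt_of_le_of_ne (not_lt.1 fun hlt => hk ⟨j, hjk, hlt⟩) fun he => hjk.ne' (π.injective he)

theorem le_add_apply_of_mem_nonMinima (h : Avoids123 π) {j : Fin n} (hj : j ∈ nonMinima π) :
    n ≤ j + π j := by
  obtain ⟨i, h1, h2⟩ := mem_nonMinima.1 hj
  have hsub : (insert i (Finset.Ioi j)).map π.toEmbedding ⊆ Finset.Iio (π j) := by
    intro x hx
    obtain ⟨y, hy, rfl⟩ := Finset.mem_map.1 hx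
    rw [Finset.mem_Iio, Equiv.coe_toEmbedding]
    rcases Finset.mem_insert.1 hy with rfl | hy
    · exact h2
    · have hy := Finset.mem_Ioi.1 hy
      exact lt_of_le_of_ne (not_lt.1 fun hlt => h ⟨i, j, y, h1, hy, h2, hlt⟩)
        fun he => hy.ne' (π.injective he)
  have := Finset.card_le_card hsub
  rw [Finset.card_map, Finset.card_insert_of_notMem (by simpa using h1.le), Fin.card_Ioi,
    Fin.card_Iio] at this
  omega

theorem reverseAdmissible_nonMinimaPositions (h : π ∈ involutions123 n) :
    ReverseAdmissible n (nonMinimaPositions π) where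
  subset := nonMinimaPositions_subset π
  le_add := by
    obtain ⟨hinv, hav⟩ := mem_involutions123.1 h
    intro j hj' k hk' he
    obtain ⟨j, hj, rfl⟩ := Finset.mem_map.1 hj'
    obtain ⟨k, hk, rfl⟩ := Finset.mem_map.1 hk'
    simp only [Fin.valEmbedding_apply] at he ⊢
    rw [nonMinimaPositions, countBelow_map_val, countBelow_map_val, Finset.card_map] at he
    have h1 := card_filter_lt_add_card_filter_gt hk
    have h2 := card_filter_lt_eq_of_strictAntiOn hinv (fun x => apply_mem_nonMinima hinv)
      (strictAntiOn_nonMinima hav) hj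
    rw [card_filter_gt_inj hk (apply_mem_nonMinima hinv hj) (by omega)]
    exact le_add_apply_of_mem_nonMinima hav hj

theorem eq_of_nonMinimaPositions_eq (hπ : π ∈ involutions123 n) (hσ : σ ∈ involutions123 n)
    (h : nonMinimaPositions π = nonMinimaPositions σ) : π = σ := by
  obtain ⟨hπ1, hπ2⟩ := mem_involutions123.1 hπ
  obtain ⟨hσ1, hσ2⟩ := mem_involutions123.1 hσ
  have h : nonMinima σ = nonMinima π := (Finset.map_injective _ h).symm
  ext1 x
  by_cases hx : x ∈ nonMinima π
  · exact eqOn_of_strictAntiOn hπ1 hσ1 (fun x => apply_mem_nonMinima hπ1)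
      (h ▸ fun x => apply_mem_nonMinima hσ1) (strictAntiOn_nonMinima hπ2)
      (h ▸ strictAntiOn_nonMinima hσ2) x hx
  · exact eqOn_of_strictAntiOn hπ1 hσ1 (fun x => apply_mem_compl_nonMinima hπ1)
      (h ▸ fun x => apply_mem_compl_nonMinima hσ1) (strictAntiOn_compl_nonMinima π)
      (h ▸ strictAntiOn_compl_nonMinima σ) x (Finset.mem_compl.2 hx)

theorem peakSet_nonMinimaPositions (h : Avoids123 π) :
    peakSet (nonMinimaPositions π) = ascentSet π := by
  ext i
  rw [mem_peakSet, ascentSet, Finset.mem_filter, Finset.mem_Ico]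
  constructor
  · rintro ⟨h1, h2, h3⟩
    obtain ⟨b, hb, rfl⟩ := Finset.mem_map.1 h1
    rw [Fin.valEmbedding_apply] at h2 h3 ⊢
    have hlt : (b : ℕ) - 1 < n := by omega
    set a : Fin n := ⟨b - 1, hlt⟩ with ha
    have h3 : a ∉ nonMinima π := fun h => h3 (coe_mem_nonMinimaPositions.2 h)
    have hab : a < b := Fin.lt_def.2 (by simp only [ha]; omega)
    refine ⟨⟨h2, b.2⟩, a, b, by simp only [ha]; omega, rfl, ?_⟩
    obtain ⟨c, hc1, hc2⟩ := mem_nonMinima.1 hb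
    rcases eq_or_ne c a with rfl | hca
    · exact hc2
    have hca : c < a := lt_of_le_of_ne
      (Fin.le_def.2 (by have := Fin.lt_def.1 hc1; simp only [ha]; omega)) hca
    refine lt_of_le_of_lt (not_lt.1 fun hlt => h3 (mem_nonMinima.2 ⟨c, hca, hlt⟩)) hc2
  · rintro ⟨-, a, b, h1, h2, h3⟩
    obtain rfl : (b : ℕ) = i := by omega
    have hab : a < b := Fin.lt_def.2 (by omega)
    refine ⟨coe_mem_nonMinimaPositions.2 (mem_nonMinima.2 ⟨a, hab, h3⟩), by omega, ?_⟩
    rw [show (b : ℕ) - 1 = a by omega, coe_mem_nonMinimaPositions, mem_nonMinima]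
    rintro ⟨c, hc1, hc2⟩
    exact h ⟨c, a, b, hc1, hab, hc2, h3⟩

end Involution

theorem exists_strictAnti_involution (α : Type*) [Fintype α] [LinearOrder α] :
    ∃ e : Equiv.Perm α, (∀ x, e (e x) = x) ∧ StrictAnti e := by
  let f := Fintype.orderIsoFinOfCardEq α rfl
  refine ⟨(f.symm.toEquiv.trans Fin.revPerm).trans f.toEquiv, fun x => by simp, fun x y hxy => ?_⟩
  simpa using hxy

theorem exists_reversal {n : ℕ} (A : Finset (Fin n)) :
    ∃ π : Equiv.Perm (Fin n), (∀ x, π (π x) = x) ∧ (∀ x, π x ∈ A ↔ x ∈ A) ∧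
      StrictAntiOn π A ∧ StrictAntiOn π (Aᶜ : Finset (Fin n)) := by
  obtain ⟨e, he1, he2⟩ := exists_strictAnti_involution {x // x ∈ A}
  obtain ⟨f, hf1, hf2⟩ := exists_strictAnti_involution {x // ¬ x ∈ A}
  have hA : ∀ x (hx : x ∈ A), Equiv.Perm.subtypeCongr e f x = e ⟨x, hx⟩ := fun x hx =>
    Equiv.Perm.subtypeCongr.left_apply e f hx
  have hAc : ∀ x (hx : x ∉ A), Equiv.Perm.subtypeCongr e f x = f ⟨x, hx⟩ := fun x hx =>
    Equiv.Perm.subtypeCongr.right_apply e f hx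
  refine ⟨Equiv.Perm.subtypeCongr e f, fun x => ?_, fun x => ?_, ?_, ?_⟩
  · by_cases hx : x ∈ A
    · rw [hA x hx, hA _ (e ⟨x, hx⟩).2, Subtype.coe_eta, he1]
    · rw [hAc x hx, hAc _ (f ⟨x, hx⟩).2, Subtype.coe_eta, hf1]
  · by_cases hx : x ∈ A
    · rw [hA x hx]; exact iff_of_true (e ⟨x, hx⟩).2 hx
    · rw [hAc x hx]; exact iff_of_false (f ⟨x, hx⟩).2 hx
  · intro x hx y hy hxy
    rw [hA x hx, hA y hy]
    exact he2 (show (⟨x, hx⟩ : {x // x ∈ A}) < ⟨y, hy⟩ from hxy)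
  · intro x hx y hy hxy
    have hx := Finset.mem_compl.1 (Finset.mem_coe.1 hx)
    have hy := Finset.mem_compl.1 (Finset.mem_coe.1 hy)
    rw [hAc x hx, hAc y hy]
    exact hf2 (show (⟨x, hx⟩ : {x // ¬ x ∈ A}) < ⟨y, hy⟩ from hxy)

theorem ReverseAdmissible.exists_involution {n : ℕ} {D : Finset ℕ} (h : ReverseAdmissible n D) :
    ∃ π ∈ involutions123 n, nonMinimaPositions π = D := by
  set A : Finset (Fin n) := Finset.univ.filter fun x => (x : ℕ) ∈ D with hA
  have hmem : ∀ x : Fin n, x ∈ A ↔ (x : ℕ) ∈ D := fun x => by simp [hA]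
  have hD : A.map Fin.valEmbedding = D := by
    ext x
    rw [Finset.mem_map]
    constructor
    · rintro ⟨y, hy, rfl⟩
      exact (hmem y).1 hy
    · intro hx
      exact ⟨⟨x, Finset.mem_range.1 (h.subset hx)⟩, (hmem _).2 hx, rfl⟩
  obtain ⟨π, hinv, hmap, hanti, hanti'⟩ := exists_reversal A
  have hmin : ∀ j ∈ A, ∃ i, i < j ∧ π i < π j := by
    intro j hj
    have h1 : n ≤ j + π j := by
      refine h.le_add _ ((hmem _).1 hj) _ ((hmem _).1 ((hmap j).2 hj)) ?_
      rw [← hD, countBelow_map_val, countBelow_map_val, Finset.card_map]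
      have h2 := card_filter_lt_add_card_filter_gt ((hmap j).2 hj)
      have h3 := card_filter_lt_eq_of_strictAntiOn hinv (fun x => (hmap x).2) hanti hj
      omega
    by_contra hc
    push Not at hc
    have hsub : (Finset.Iio j).map π.toEmbedding ⊆ Finset.Ioi (π j) := by
      intro x hx
      obtain ⟨y, hy, rfl⟩ := Finset.mem_map.1 hx
      have hy := Finset.mem_Iio.1 hy
      exact Finset.mem_Ioi.2 (lt_of_le_of_ne (hc y hy) fun he => hy.ne' (π.injective he))
    have := Finset.card_le_card hsub
    rw [Finset.card_map, Fin.card_Ioi, Fin.card_Iio] at this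
    omega
  have hnon : nonMinima π = A := by
    ext i
    rw [mem_nonMinima]
    refine ⟨?_, hmin i⟩
    rintro ⟨j, hji, hlt⟩
    by_contra hi
    have hi' : i ∈ (Aᶜ : Finset (Fin n)) := Finset.mem_compl.2 hi
    by_cases hj : j ∈ A
    · obtain ⟨k, hkj, hlt'⟩ := hmin j hj
      by_cases hk : k ∈ A
      · exact lt_asymm hlt' (hanti hk hj hkj)
      · exact lt_asymm (hlt'.trans hlt) (hanti' (Finset.mem_compl.2 hk) hi' (hkj.trans hji))
    · exact lt_asymm hlt (hanti' (Finset.mem_compl.2 hj) hi' hji)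
  refine ⟨π, mem_involutions123.2 ⟨hinv, ?_⟩, by rw [nonMinimaPositions, hnon, hD]⟩
  rintro ⟨a, b, c, hab, hbc, h1, h2⟩
  have hA : ∀ x y, x < y → π x < π y → x ∈ A → y ∉ A := fun x y hxy hlt hx hy =>
    lt_asymm hlt (hanti hx hy hxy)
  have hAc : ∀ x y, x < y → π x < π y → x ∉ A → y ∈ A := fun x y hxy hlt hx => by
    by_contra hy
    exact lt_asymm hlt (hanti' (Finset.mem_compl.2 hx) (Finset.mem_compl.2 hy) hxy)
  by_cases hb : b ∈ A
  · by_cases ha : a ∈ A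
    · exact hA a b hab h1 ha hb
    · have hc := hA b c hbc h2 hb
      exact hc (hAc a c (hab.trans hbc) (h1.trans h2) ha)
  · have hc := hAc b c hbc h2 hb
    by_cases ha : a ∈ A
    · exact hA a c (hab.trans hbc) (h1.trans h2) ha hc
    · exact hb (hAc a b hab h1 ha)

theorem finite_setOf_isBallot (n : ℕ) : {Z | IsBallot n Z}.Finite :=
  (Finset.range n).powerset.finite_toSet.subset fun _ hZ =>
    Finset.mem_coe.2 (Finset.mem_powerset.2 hZ.subset)

/-- `123`-avoiding involutions with a given ascent set are equinumerous with ballot words with that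
set of peaks. -/
theorem card_involutions123_ascentSet (n : ℕ) (S : Finset ℕ) :
    Nat.card {π : Equiv.Perm (Fin n) // π ∈ involutions123 n ∧ ascentSet π = S} =
      Nat.card {Z : Finset ℕ // IsBallot n Z ∧ peakSet Z = S} := by
  have : Finite {Z // IsBallot n Z} := (finite_setOf_isBallot n).to_subtype
  let f : {π // π ∈ involutions123 n} → {Z // IsBallot n Z} := fun π =>
    ⟨ballotOf n (nonMinimaPositions π.1),
      (reverseAdmissible_nonMinimaPositions π.2).isBallot_ballotOf⟩
  have hf : Function.Injective f := fun π σ h => Subtype.ext <|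
    eq_of_nonMinimaPositions_eq π.2 σ.2 <|
      (reverseAdmissible_nonMinimaPositions π.2).eq_of_ballotOf_eq
        (reverseAdmissible_nonMinimaPositions σ.2) (Subtype.ext_iff.1 h)
  have hg : ∀ Z : {Z // IsBallot n Z}, ∃ π : {π // π ∈ involutions123 n},
      nonMinimaPositions π.1 = foldBallot n Z.1 := fun Z => by
    obtain ⟨π, h1, h2⟩ := Z.2.reverseAdmissible_foldBallot.exists_involution
    exact ⟨⟨π, h1⟩, h2⟩
  choose g hg using hg
  have hg' : Function.Injective g := fun Z Y h => Subtype.ext <|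
    Z.2.eq_of_foldBallot_eq Y.2 (by rw [← hg, ← hg, h])
  have hfb := hf.bijective_of_nat_card_le (Nat.card_le_card_of_injective g hg')
  have hpeak : ∀ π, peakSet (f π).1 = ascentSet π.1 := fun π => by
    rw [(reverseAdmissible_nonMinimaPositions π.2).peakSet_ballotOf,
      peakSet_nonMinimaPositions (mem_involutions123.1 π.2).2]
  refine Nat.card_eq_of_bijective
    (fun π => ⟨(f ⟨π.1, π.2.1⟩).1, (f ⟨π.1, π.2.1⟩).2, (hpeak _).trans π.2.2⟩) ⟨?_, ?_⟩
  · intro π σ h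
    simp only [Subtype.mk.injEq] at h
    have h := hf (Subtype.ext h)
    exact Subtype.ext (Subtype.mk_eq_mk.1 h)
  · rintro ⟨Z, hZ, hS⟩
    obtain ⟨π, hπ⟩ := hfb.2 ⟨Z, hZ⟩
    refine ⟨⟨π.1, π.2, ?_⟩, Subtype.ext ?_⟩
    · rw [← hpeak, hπ, hS]
    · change (f π).1 = Z
      rw [hπ]

/-! The number of words with given peaks, minimal height `-a` and final height `c - 2 * a` does not
depend on `a ≤ c`. -/

theorem countBelow_erase_of_le {Z : Finset ℕ} {x y : ℕ} (hy : y ≤ x) :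
    countBelow (Z.erase x) y = countBelow Z y := by
  unfold countBelow
  congr 1
  ext z
  simp only [Finset.mem_filter, Finset.mem_erase]
  constructor
  · rintro ⟨⟨-, h1⟩, h2⟩
    exact ⟨h1, h2⟩
  · rintro ⟨h1, h2⟩
    exact ⟨⟨by omega, h1⟩, h2⟩

theorem countBelow_erase_of_lt {Z : Finset ℕ} {x y : ℕ} (hx : x ∈ Z) (hy : x < y) :
    countBelow (Z.erase x) y + 1 = countBelow Z y := by
  unfold countBelow
  rw [Finset.filter_erase]
  exact Finset.card_erase_add_one (Finset.mem_filter.2 ⟨hx, hy⟩)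

theorem peakSet_erase {Z : Finset ℕ} {x : ℕ} (hpred : x = 0 ∨ x - 1 ∈ Z)
    (hsucc : x + 1 ∉ Z) : peakSet (Z.erase x) = peakSet Z := by
  ext i
  simp only [mem_peakSet, Finset.mem_erase]
  constructor
  · rintro ⟨⟨h1, h2⟩, h3, h4⟩
    refine ⟨h2, h3, fun h5 => h4 ⟨?_, h5⟩⟩
    rintro rfl
    rw [Nat.sub_add_cancel h3] at hsucc
    exact hsucc h2
  · rintro ⟨h1, h2, h3⟩
    refine ⟨⟨?_, h1⟩, h2, fun h4 => h3 h4.2⟩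
    rintro rfl
    rcases hpred with h | h
    · omega
    · exact h3 h

/-- The word with letters `D` at the positions in `Z` has length `n`, peaks `S`, minimal height
`-a` and final height `c - 2 * a`. -/
structure HasDepth (n : ℕ) (S : Finset ℕ) (a c : ℕ) (Z : Finset ℕ) : Prop where
  subset : Z ⊆ Finset.range n
  peaks : peakSet Z = S
  le : ∀ x, 2 * countBelow Z x ≤ x + a
  attained : ∃ x, 2 * countBelow Z x = x + a
  card : n + 2 * a = 2 * Z.card + c

/-- The step at `x` is the first one that reaches height `-(a + 1)`. -/
def IsFirstDescent (a : ℕ) (Z : Finset ℕ) (x : ℕ) : Prop :=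
  2 * countBelow Z x = x + a ∧ x ∈ Z ∧ ∀ y ≤ x, 2 * countBelow Z y ≤ y + a

/-- Height `-a` is left for the last time by the step at `x`. -/
def IsLastAscent (a : ℕ) (Z : Finset ℕ) (x : ℕ) : Prop :=
  2 * countBelow Z x = x + a ∧ x ∉ Z ∧ ∀ y, x < y → 2 * countBelow Z y < y + a

theorem IsFirstDescent.unique {a : ℕ} {Z : Finset ℕ} {x y : ℕ} (hx : IsFirstDescent a Z x)
    (hy : IsFirstDescent a Z y) : x = y := by
  by_contra hne
  wlog hlt : x < y generalizing x y
  · exact this hy hx (Ne.symm hne) (by omega)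
  have h1 := hy.2.2 (x + 1) hlt
  rw [countBelow_succ, if_pos hx.2.1] at h1
  have := hx.1
  omega

theorem IsLastAscent.unique {a : ℕ} {Z : Finset ℕ} {x y : ℕ} (hx : IsLastAscent a Z x)
    (hy : IsLastAscent a Z y) : x = y := by
  by_contra hne
  wlog hlt : x < y generalizing x y
  · exact this hy hx (Ne.symm hne) (by omega)
  have h1 := hx.2.2 y hlt
  have := hy.1
  omega

namespace HasDepth

variable {n : ℕ} {S : Finset ℕ} {a c : ℕ} {Z : Finset ℕ}

theorem exists_raise (h : HasDepth n S (a + 1) c Z) :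
    ∃ x, IsFirstDescent a Z x ∧ IsLastAscent a (Z.erase x) x ∧
      HasDepth n S a c (Z.erase x) := by
  have hex := h.attained
  have h0 := Nat.find_spec hex
  have hmin : ∀ y < Nat.find hex, 2 * countBelow Z y ≤ y + a := fun y hy => by
    have h1 := Nat.find_min hex hy
    have h2 := h.le y
    omega
  generalize Nat.find hex = t at h0 hmin
  obtain _ | x := t
  · rw [countBelow_zero] at h0; omega
  have h1 := hmin x (Nat.lt_succ_self x)
  rw [countBelow_succ] at h0
  have hx : x ∈ Z := by
    by_contra hx
    rw [if_neg hx] at h0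
    omega
  rw [if_pos hx] at h0
  have hlast : ∀ y, x < y → 2 * countBelow (Z.erase x) y < y + a := fun y hy => by
    have h2 := h.le y
    have h3 := countBelow_erase_of_lt hx hy
    omega
  refine ⟨x, ⟨by omega, hx, fun y hy => hmin y (by omega)⟩, ⟨?_, by simp, hlast⟩, ?_⟩
  · rw [countBelow_erase_of_le le_rfl]; omega
  · refine ⟨(Finset.erase_subset _ _).trans h.subset, ?_, fun y => ?_, ⟨x, ?_⟩, ?_⟩
    · rw [peakSet_erase, h.peaks]
      · by_contra hc
        push Not at hc
        have h2 := countBelow_succ Z (x - 1)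
        rw [Nat.sub_add_cancel (by omega), if_neg hc.2] at h2
        have h3 := hmin (x - 1) (by omega)
        omega
      · intro hc
        have h2 := h.le (x + 2)
        rw [countBelow_succ, countBelow_succ, if_pos hc, if_pos hx] at h2
        omega
    · rcases le_or_gt y x with hy | hy
      · rw [countBelow_erase_of_le hy]; exact hmin y (by omega)
      · exact (hlast y hy).le
    · rw [countBelow_erase_of_le le_rfl]; omega
    · have := h.card
      have := Finset.card_erase_add_one hx
      omega

theorem exists_lower (h : HasDepth n S a c Z) (hac : a + 1 ≤ c) :
    ∃ x, IsLastAscent a Z x ∧ IsFirstDescent a (insert x Z) x ∧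
      HasDepth n S (a + 1) c (insert x Z) := by
  have hbound : ∀ x, 2 * countBelow Z x = x + a → x < n := by
    intro x hx
    by_contra hxn
    have h1 : countBelow Z x ≤ Z.card := Finset.card_filter_le _ _
    have h2 := h.card
    omega
  obtain ⟨x, hx, hlast⟩ : ∃ x, 2 * countBelow Z x = x + a ∧
      ∀ y, x < y → 2 * countBelow Z y < y + a := by
    obtain ⟨x₀, hx₀⟩ := h.attained
    have hP := Nat.findGreatest_spec (P := fun x => 2 * countBelow Z x = x + a)
      (hbound x₀ hx₀).le hx₀
    refine ⟨_, hP, fun y hy => lt_of_le_of_ne (h.le y) fun he => ?_⟩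
    exact absurd (Nat.le_findGreatest (P := fun x => 2 * countBelow Z x = x + a)
      (hbound y he).le he) (not_le.2 hy)
  have hxZ : x ∉ Z := by
    intro hxZ
    have h1 := h.le (x + 1)
    rw [countBelow_succ, if_pos hxZ] at h1
    omega
  have hle : ∀ y ≤ x, countBelow (insert x Z) y = countBelow Z y := fun y hy => by
    rw [← countBelow_erase_of_le (Z := insert x Z) hy, Finset.erase_insert hxZ]
  have hgt : ∀ y, x < y → countBelow (insert x Z) y = countBelow Z y + 1 := fun y hy => by
    rw [← countBelow_erase_of_lt (Z := insert x Z) (Finset.mem_insert_self x Z) hy,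
      Finset.erase_insert hxZ]
  refine ⟨x, ⟨hx, hxZ, hlast⟩, ⟨?_, Finset.mem_insert_self x Z, fun y hy => ?_⟩, ?_⟩
  · rw [hle x le_rfl, hx]
  · rw [hle y hy]; exact h.le y
  · refine ⟨?_, ?_, fun y => ?_, ⟨x + 1, ?_⟩, ?_⟩
    · exact Finset.insert_subset (Finset.mem_range.2 (hbound x hx)) h.subset
    · rw [← peakSet_erase (Z := insert x Z) (x := x), Finset.erase_insert hxZ, h.peaks]
      · by_contra hc
        push Not at hc
        have h2 := countBelow_succ Z (x - 1)
        rw [Nat.sub_add_cancel (by omega),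
          if_neg fun hm => hc.2 (Finset.mem_insert_of_mem hm)] at h2
        have h3 := h.le (x - 1)
        omega
      · intro hc
        have hc : x + 1 ∈ Z := (Finset.mem_insert.1 hc).resolve_left (by omega)
        have h2 := hlast (x + 2) (by omega)
        rw [countBelow_succ, countBelow_succ, if_pos hc, if_neg hxZ] at h2
        omega
    · rcases le_or_gt y x with hy | hy
      · rw [hle y hy]; have := h.le y; omega
      · rw [hgt y hy]; have := hlast y hy; omega
    · rw [hgt _ (Nat.lt_succ_self x), countBelow_succ, if_neg hxZ]; omega
    · rw [Finset.card_insert_of_notMem hxZ]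
      have := h.card
      omega

theorem eq_of_hasDepth {a' c' : ℕ} (h : HasDepth n S a c Z) (h' : HasDepth n S a' c' Z) :
    a = a' ∧ c = c' := by
  obtain ⟨x, hx⟩ := h.attained
  obtain ⟨y, hy⟩ := h'.attained
  have h1 := h.le y
  have h2 := h'.le x
  have h3 := h.card
  have h4 := h'.card
  omega

end HasDepth

theorem exists_hasDepth {n : ℕ} {Z : Finset ℕ} (hZ : Z ⊆ Finset.range n) :
    ∃ a c, HasDepth n (peakSet Z) a c Z := by
  classical
  have hex : ∃ a, ∀ x, 2 * countBelow Z x ≤ x + a := ⟨Z.card, fun x => by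
    have h1 := countBelow_le Z x
    have h2 : countBelow Z x ≤ Z.card := Finset.card_filter_le _ _
    omega⟩
  have h0 := Nat.find_spec hex
  have hmin : ∀ b < Nat.find hex, ∃ x, x + b < 2 * countBelow Z x := fun b hb => by
    simpa using Nat.find_min hex hb
  generalize Nat.find hex = a at h0 hmin
  have hn := h0 n
  rw [countBelow_eq_card hZ] at hn
  have hc : 2 * Z.card ≤ n + 2 * a := by omega
  refine ⟨a, n + 2 * a - 2 * Z.card, hZ, rfl, h0, ?_, by omega⟩
  obtain _ | b := a
  · exact ⟨0, by simp [countBelow_zero]⟩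
  · obtain ⟨x, hx⟩ := hmin b (Nat.lt_succ_self b)
    exact ⟨x, by have := h0 x; omega⟩

open Classical in
/-- The words with given peaks and given minimal and final height. -/
noncomputable def depthClass (n : ℕ) (S : Finset ℕ) (a c : ℕ) : Finset (Finset ℕ) :=
  (Finset.range n).powerset.filter (HasDepth n S a c)

theorem mem_depthClass {n : ℕ} {S : Finset ℕ} {a c : ℕ} {Z : Finset ℕ} :
    Z ∈ depthClass n S a c ↔ HasDepth n S a c Z := by
  simp only [depthClass, Finset.mem_filter, Finset.mem_powerset, and_iff_right_iff_imp]
  exact HasDepth.subset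

theorem card_depthClass_succ (n : ℕ) (S : Finset ℕ) {a c : ℕ} (hac : a + 1 ≤ c) :
    (depthClass n S (a + 1) c).card = (depthClass n S a c).card := by
  apply le_antisymm
  · have h : ∀ Z : depthClass n S (a + 1) c, ∃ x, IsFirstDescent a Z.1 x ∧
        IsLastAscent a (Z.1.erase x) x ∧ HasDepth n S a c (Z.1.erase x) := fun Z =>
      (mem_depthClass.1 Z.2).exists_raise
    choose f h1 h2 h3 using h
    refine Finset.card_le_card_of_injective (f := fun Z => ⟨Z.1.erase (f Z),
      mem_depthClass.2 (h3 Z)⟩) fun Z Y he => Subtype.ext ?_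
    have he : Z.1.erase (f Z) = Y.1.erase (f Y) := Subtype.ext_iff.1 he
    have hx : f Z = f Y := (h2 Z).unique (he ▸ h2 Y)
    rw [← Finset.insert_erase (h1 Z).2.1, ← Finset.insert_erase (h1 Y).2.1, he, hx]
  · have h : ∀ Z : depthClass n S a c, ∃ x, IsLastAscent a Z.1 x ∧
        IsFirstDescent a (insert x Z.1) x ∧ HasDepth n S (a + 1) c (insert x Z.1) := fun Z =>
      (mem_depthClass.1 Z.2).exists_lower hac
    choose f h1 h2 h3 using h
    refine Finset.card_le_card_of_injective (f := fun Z => ⟨insert (f Z) Z.1,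
      mem_depthClass.2 (h3 Z)⟩) fun Z Y he => Subtype.ext ?_
    have he : insert (f Z) Z.1 = insert (f Y) Y.1 := Subtype.ext_iff.1 he
    have hx : f Z = f Y := (h2 Z).unique (he ▸ h2 Y)
    rw [← Finset.erase_insert (h1 Z).2.1, ← Finset.erase_insert (h1 Y).2.1, he, hx]

theorem card_depthClass (n : ℕ) (S : Finset ℕ) {a c : ℕ} (hac : a ≤ c) :
    (depthClass n S a c).card = (depthClass n S 0 c).card := by
  induction a with
  | zero => rfl
  | succ a ih => rw [card_depthClass_succ n S hac, ih (by omega)]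

theorem card_biUnion_depthClass (n : ℕ) (S : Finset ℕ) (f : ℕ → ℕ) (N : ℕ) :
    ((Finset.range N).biUnion fun c => depthClass n S (f c) c).card =
      ∑ c ∈ Finset.range N, (depthClass n S (f c) c).card := by
  refine Finset.card_biUnion fun c _ c' _ hne => Finset.disjoint_left.2 fun Z h1 h2 => hne ?_
  exact ((mem_depthClass.1 h1).eq_of_hasDepth (mem_depthClass.1 h2)).2

/-- The words with `p` letters `U`, `q` letters `D` and peaks `S`. -/
structure IsWord (S : Finset ℕ) (p q : ℕ) (Z : Finset ℕ) : Prop where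
  subset : Z ⊆ Finset.range (p + q)
  card : Z.card = q
  peaks : peakSet Z = S

theorem card_ballot_eq_card_word (n : ℕ) (S : Finset ℕ) :
    Nat.card {Z : Finset ℕ // IsBallot n Z ∧ peakSet Z = S} =
      Nat.card {Z : Finset ℕ // IsWord S ((n + 1) / 2) (n / 2) Z} := by
  have hB : ∀ Z, (IsBallot n Z ∧ peakSet Z = S) ↔
      Z ∈ (Finset.range (n + 1)).biUnion fun c => depthClass n S 0 c := by
    intro Z
    simp only [Finset.mem_biUnion, mem_depthClass, Finset.mem_range]
    constructor
    · rintro ⟨h, hS⟩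
      have h1 := h.le n
      rw [countBelow_eq_card h.subset] at h1
      exact ⟨n - 2 * Z.card, by omega, h.subset, hS, h.le, ⟨0, by simp [countBelow_zero]⟩,
        by omega⟩
    · rintro ⟨c, -, h⟩
      exact ⟨⟨h.subset, h.le⟩, h.peaks⟩
  have hW : ∀ Z, IsWord S ((n + 1) / 2) (n / 2) Z ↔
      Z ∈ (Finset.range (n + 1)).biUnion fun c => depthClass n S (c / 2) c := by
    intro Z
    simp only [Finset.mem_biUnion, mem_depthClass, Finset.mem_range]
    constructor
    · rintro ⟨h1, h2, h3⟩
      rw [show (n + 1) / 2 + n / 2 = n by omega] at h1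
      obtain ⟨a, c, h⟩ := exists_hasDepth h1
      rw [h3] at h
      have h4 := h.card
      obtain ⟨x, hx⟩ := h.attained
      have h5 : countBelow Z x ≤ Z.card := Finset.card_filter_le _ _
      have h6 := countBelow_le Z x
      have h7 : c / 2 = a := by omega
      exact ⟨c, by omega, h7 ▸ h⟩
    · rintro ⟨c, -, h⟩
      have h4 := h.card
      refine ⟨?_, by omega, h.peaks⟩
      rw [show (n + 1) / 2 + n / 2 = n by omega]
      exact h.subset
  simp only [hB, hW, Nat.card_eq_fintype_card, Fintype.card_coe]
  rw [card_biUnion_depthClass, card_biUnion_depthClass]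
  exact Finset.sum_congr rfl fun c _ => (card_depthClass n S (Nat.div_le_self c 2)).symm

/-! Words are built up by their last peak. -/

/-- The peaks of the word that arises from a word of length `i - 1` by appending a letter `U`,
`k` letters `D` and any number of letters `U`. -/
theorem peakSet_union_Ico {Y : Finset ℕ} {i k : ℕ} (hi : 1 ≤ i) (hk : 0 < k)
    (hY : Y ⊆ Finset.range (i - 1)) :
    peakSet (Y ∪ Finset.Ico i (i + k)) = insert i (peakSet Y) := by
  have hY : ∀ y ∈ Y, y < i - 1 := fun y hy => Finset.mem_range.1 (hY hy)
  ext x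
  simp only [mem_peakSet, Finset.mem_union, Finset.mem_Ico, Finset.mem_insert]
  constructor
  · rintro ⟨h1 | h1, h2, h3⟩
    · exact Or.inr ⟨h1, h2, fun h => h3 (Or.inl h)⟩
    · refine Or.inl ?_
      by_contra hne
      exact h3 (Or.inr (by omega))
  · rintro (rfl | ⟨h1, h2, h3⟩)
    · refine ⟨Or.inr (by omega), by omega, ?_⟩
      rintro (h | h)
      · exact lt_irrefl _ (hY _ h)
      · omega
    · have := hY x h1
      refine ⟨Or.inl h1, h2, ?_⟩
      rintro (h | h)
      · exact h3 h
      · omega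

theorem eq_Ico_of_forall_pred_mem {T : Finset ℕ} {i : ℕ} (hi : ∀ z ∈ T, i ≤ z)
    (h : ∀ z ∈ T, i < z → z - 1 ∈ T) : T = Finset.Ico i (i + T.card) := by
  rcases T.eq_empty_or_nonempty with rfl | hne
  · simp
  have hdown : ∀ k, ∀ z ∈ T, i + k ≤ z → z - k ∈ T := by
    intro k
    induction k with
    | zero => exact fun z hz _ => hz
    | succ k ih =>
      intro z hz hk
      exact h (z - k) (ih z hz (by omega)) (by omega)
  have hT : T = Finset.Ico i (T.max' hne + 1) := by
    ext x
    rw [Finset.mem_Ico]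
    constructor
    · exact fun hx => ⟨hi x hx, Nat.lt_succ_of_le (T.le_max' x hx)⟩
    · rintro ⟨h1, h2⟩
      have := hdown (T.max' hne - x) _ (T.max'_mem hne) (by omega)
      rwa [show T.max' hne - (T.max' hne - x) = x by omega] at this
  have h1 := hi _ (T.max'_mem hne)
  have h2 : T.card = T.max' hne + 1 - i := by conv_lhs => rw [hT, Nat.card_Ico]
  rw [h2]
  conv_lhs => rw [hT]
  congr 1
  omega

/-- The possible numbers of letters `D` before the last peak `i`. -/
abbrev LegChoice (i p q : ℕ) : Type := {b : ℕ // b < q ∧ i ≤ b + p ∧ b < i}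

namespace IsWord

variable {S : Finset ℕ} {i p q : ℕ} {Z : Finset ℕ}

theorem append (hi : 1 ≤ i) (b : LegChoice i p q)
    (h : IsWord S (i - 1 - b.1) b.1 Z) :
    IsWord (insert i S) p q (Z ∪ Finset.Ico i (i + (q - b.1))) := by
  obtain ⟨b, h1, h2, h3⟩ := b
  have hsub : Z ⊆ Finset.range (i - 1) := by
    have := h.subset
    rwa [Nat.sub_add_cancel (by dsimp only; omega)] at this
  refine ⟨?_, ?_, ?_⟩
  · refine Finset.union_subset (hsub.trans (Finset.range_subset_range.2 (by omega))) fun x hx => ?_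
    rw [Finset.mem_Ico] at hx
    dsimp only at hx
    exact Finset.mem_range.2 (by omega)
  · rw [Finset.card_union_of_disjoint, h.card, Nat.card_Ico]
    · dsimp only; omega
    · refine Finset.disjoint_left.2 fun x hx hx' => ?_
      have := Finset.mem_range.1 (hsub hx)
      have := (Finset.mem_Ico.1 hx').1
      omega
  · rw [peakSet_union_Ico hi (by dsimp only; omega) hsub, h.peaks]

theorem filter_append (hi : 1 ≤ i) (b : LegChoice i p q)
    (h : IsWord S (i - 1 - b.1) b.1 Z) (k : ℕ) :
    (Z ∪ Finset.Ico i (i + k)).filter (· < i) = Z := by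
  have hsub : Z ⊆ Finset.range (i - 1) := by
    have := h.subset
    rwa [Nat.sub_add_cancel (by have := b.2; omega)] at this
  ext x
  simp only [Finset.mem_filter, Finset.mem_union, Finset.mem_Ico]
  constructor
  · rintro ⟨h1 | h1, h2⟩
    · exact h1
    · omega
  · intro hx
    have := Finset.mem_range.1 (hsub hx)
    exact ⟨Or.inl hx, by omega⟩

theorem exists_append (hi : 1 ≤ i) (hS : ∀ j ∈ S, j < i) (h : IsWord (insert i S) p q Z) :
    ∃ b : LegChoice i p q, IsWord S (i - 1 - b.1) b.1 (Z.filter (· < i)) ∧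
      Z.filter (· < i) ∪ Finset.Ico i (i + (q - b.1)) = Z := by
  have hiZ := mem_peakSet.1 (h.peaks ▸ Finset.mem_insert_self i S)
  have hsub : Z.filter (· < i) ⊆ Finset.range (i - 1) := by
    intro x hx
    rw [Finset.mem_filter] at hx
    have : x ≠ i - 1 := by
      rintro rfl
      exact hiZ.2.2 hx.1
    exact Finset.mem_range.2 (by omega)
  have hcard : (Z.filter (· < i)).card ≤ i - 1 :=
    (Finset.card_le_card hsub).trans (Finset.card_range _).le
  have hsplit := Finset.card_filter_add_card_filter_not (s := Z) (· < i)
  rw [h.card] at hsplit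
  have hT : Z.filter (¬ · < i) = Finset.Ico i (i + (Z.filter (¬ · < i)).card) := by
    apply eq_Ico_of_forall_pred_mem
    · intro z hz
      exact not_lt.1 (Finset.mem_filter.1 hz).2
    · intro z hz hiz
      refine Finset.mem_filter.2 ⟨?_, by omega⟩
      by_contra hc
      have : z ∈ insert i S :=
        h.peaks ▸ mem_peakSet.2 ⟨(Finset.mem_filter.1 hz).1, by omega, hc⟩
      rcases Finset.mem_insert.1 this with rfl | hz'
      · exact lt_irrefl _ hiz
      · exact lt_asymm hiz (hS z hz')
  have hpos : 0 < (Z.filter (¬ · < i)).card :=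
    Finset.card_pos.2 ⟨i, Finset.mem_filter.2 ⟨hiZ.1, lt_irrefl i⟩⟩
  have hlast : i + (Z.filter (¬ · < i)).card - 1 ∈ Z.filter (¬ · < i) := by
    rw [hT, Finset.mem_Ico, ← hT]
    omega
  have hlast := Finset.mem_range.1 (h.subset (Finset.mem_filter.1 hlast).1)
  refine ⟨⟨(Z.filter (· < i)).card, by omega, by omega, by omega⟩, ⟨?_, rfl, ?_⟩, ?_⟩
  · dsimp only
    rwa [Nat.sub_add_cancel hcard]
  · ext x
    rw [mem_peakSet, Finset.mem_filter, Finset.mem_filter]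
    constructor
    · rintro ⟨⟨h1, h2⟩, h3, h4⟩
      have : x ∈ insert i S :=
        h.peaks ▸ mem_peakSet.2 ⟨h1, h3, fun h5 => h4 ⟨h5, by omega⟩⟩
      exact (Finset.mem_insert.1 this).resolve_left (by omega)
    · intro hx
      have h1 := mem_peakSet.1 (h.peaks ▸ Finset.mem_insert_of_mem (b := i) hx)
      exact ⟨⟨h1.1, hS x hx⟩, h1.2.1, fun h2 => h1.2.2 h2.1⟩
  · dsimp only
    rw [show q - (Z.filter (· < i)).card = (Z.filter (¬ · < i)).card by omega, ← hT,
      Finset.filter_union_filter_not_eq]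

/-- Decomposition of words at the last peak. -/
theorem nonempty_equiv (hi : 1 ≤ i) (hS : ∀ j ∈ S, j < i) :
    Nonempty ((Σ b : LegChoice i p q, {Z // IsWord S (i - 1 - b.1) b.1 Z}) ≃
      {Z // IsWord (insert i S) p q Z}) := by
  refine ⟨Equiv.ofBijective (fun x => ⟨_, x.2.2.append hi x.1⟩) ⟨?_, ?_⟩⟩
  · rintro ⟨b, Z, hZ⟩ ⟨c, Y, hY⟩ he
    have he := congrArg (fun X : Finset ℕ => X.filter (· < i)) (Subtype.mk_eq_mk.1 he)
    dsimp only at he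
    rw [filter_append hi b hZ, filter_append hi c hY] at he
    subst he
    obtain rfl : b = c := Subtype.ext (hZ.card.symm.trans hY.card)
    rfl
  · rintro ⟨Z, hZ⟩
    obtain ⟨b, h1, h2⟩ := hZ.exists_append hi hS
    exact ⟨⟨b, _, h1⟩, Subtype.ext h2⟩

theorem isWord_empty_iff : IsWord ∅ p q Z ↔ Z = Finset.range q := by
  constructor
  · intro h
    have hZ := eq_Ico_of_forall_pred_mem (T := Z) (i := 0) (fun z _ => Nat.zero_le z) ?_
    · rw [hZ, h.card, zero_add, Nat.Ico_zero_eq_range]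
    · intro z hz h0
      by_contra hc
      exact Finset.notMem_empty z (h.peaks ▸ mem_peakSet.2 ⟨hz, h0, hc⟩)
  · rintro rfl
    refine ⟨Finset.range_subset_range.2 (by omega), Finset.card_range q, ?_⟩
    rw [Finset.eq_empty_iff_forall_notMem]
    intro x hx
    simp only [mem_peakSet, Finset.mem_range] at hx
    omega

end IsWord

namespace YoungDiagram

variable {μ ν : YoungDiagram}

theorem lt_durfeeSide_iff {k : ℕ} : k < μ.durfeeSide ↔ (k, k) ∈ μ := by
  constructor
  · intro hk
    have h1 := Nat.findGreatest_of_ne_zero (P := fun k => k ≤ μ.rowLen (k - 1))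
      (n := μ.colLen 0) (m := μ.durfeeSide) rfl (by omega)
    have h2 : (μ.durfeeSide - 1, μ.durfeeSide - 1) ∈ μ := mem_iff_lt_rowLen.2 (by omega)
    exact μ.up_left_mem (by omega) (by omega) h2
  · intro hk
    refine Nat.le_findGreatest (P := fun k => k ≤ μ.rowLen (k - 1)) ?_ ?_
    · exact mem_iff_lt_colLen.1 (μ.up_left_mem le_rfl (Nat.zero_le k) hk)
    · exact mem_iff_lt_rowLen.1 hk

theorem durfeeSide_eq_succ (h : (0, 0) ∈ μ) : μ.durfeeSide = μ.removeHook.durfeeSide + 1 := by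
  refine eq_of_forall_lt_iff fun k => ?_
  obtain _ | k := k
  · simp [lt_durfeeSide_iff, h]
  · rw [lt_durfeeSide_iff, Nat.add_lt_add_iff_right, lt_durfeeSide_iff, mem_removeHook]

theorem zero_mem_iff_rowLen : (0, 0) ∈ μ ↔ 0 < μ.rowLen 0 := mem_iff_lt_rowLen

theorem zero_mem_iff_colLen : (0, 0) ∈ μ ↔ 0 < μ.colLen 0 := mem_iff_lt_colLen

theorem card_largestHook_add_one (h : (0, 0) ∈ μ) :
    μ.largestHook.card + 1 = μ.rowLen 0 + μ.colLen 0 := by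
  have hinter : μ.row 0 ∩ μ.col 0 = {(0, 0)} := by
    ext ⟨x, y⟩
    simp only [Finset.mem_inter, mem_row_iff, mem_col_iff, Finset.mem_singleton, Prod.mk.injEq]
    constructor
    · rintro ⟨⟨-, h1⟩, -, h2⟩
      exact ⟨h1, h2⟩
    · rintro ⟨rfl, rfl⟩
      exact ⟨⟨h, rfl⟩, h, rfl⟩
  have := Finset.card_union_add_card_inter (μ.row 0) (μ.col 0)
  rwa [hinter, Finset.card_singleton, ← rowLen_eq_card, ← colLen_eq_card] at this

theorem hookDecomposition_eq_insert (h : (0, 0) ∈ μ) :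
    μ.hookDecomposition = insert μ.largestHook.card μ.removeHook.hookDecomposition := by
  rw [hookDecomposition, durfeeSide_eq_succ h, hookDecomposition]
  ext x
  simp only [Finset.mem_image, Finset.mem_range, Finset.mem_insert]
  constructor
  · rintro ⟨r, hr, rfl⟩
    obtain _ | r := r
    · exact Or.inl rfl
    · exact Or.inr ⟨r, by omega, rfl⟩
  · rintro (rfl | ⟨r, hr, rfl⟩)
    · exact ⟨0, by omega, rfl⟩
    · exact ⟨r + 1, by omega, rfl⟩

theorem hookDecomposition_eq_empty_iff : μ.hookDecomposition = ∅ ↔ (0, 0) ∉ μ := by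
  constructor
  · intro h h0
    rw [hookDecomposition_eq_insert h0] at h
    exact Finset.insert_ne_empty _ _ h
  · intro h
    have : μ.durfeeSide = 0 := by
      by_contra hne
      exact h (lt_durfeeSide_iff.1 (Nat.pos_of_ne_zero hne))
    simp [hookDecomposition, this]

theorem eq_bot_iff_zero_notMem : μ = ⊥ ↔ (0, 0) ∉ μ := by
  constructor
  · rintro rfl
    exact notMem_bot _
  · intro h
    ext ⟨x, y⟩
    simp only [mem_cells]
    exact iff_of_false
      (fun hxy => h (μ.up_left_mem (Nat.zero_le x) (Nat.zero_le y) hxy)) (notMem_bot _)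

theorem rowLen_removeHook_le : μ.removeHook.rowLen 0 ≤ μ.rowLen 0 - 1 := by
  by_contra! h
  have h1 := mem_removeHook.1 (mem_iff_lt_rowLen.2 h)
  have h2 := mem_iff_lt_rowLen.1 (μ.up_left_mem (Nat.zero_le (0 + 1)) le_rfl h1)
  omega

theorem colLen_removeHook_le : μ.removeHook.colLen 0 ≤ μ.colLen 0 - 1 := by
  by_contra! h
  have h1 := mem_removeHook.1 (mem_iff_lt_colLen.2 h)
  have h2 := mem_iff_lt_colLen.1 (μ.up_left_mem le_rfl (Nat.zero_le (0 + 1)) h1)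
  omega

theorem lt_of_mem_hookDecomposition {h : ℕ} (hh : h ∈ μ.hookDecomposition) :
    h < μ.rowLen 0 + μ.colLen 0 := by
  induction hn : μ.durfeeSide generalizing μ with
  | zero => simp [hookDecomposition, hn] at hh
  | succ n ih =>
    have h0 : (0, 0) ∈ μ := lt_durfeeSide_iff.1 (by omega)
    have h1 := durfeeSide_eq_succ h0
    rw [hookDecomposition_eq_insert h0, Finset.mem_insert] at hh
    rcases hh with rfl | hh
    · have := card_largestHook_add_one h0
      omega
    · have h2 := ih hh (by omega)
      have h3 := rowLen_removeHook_le (μ := μ)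
      have h4 := colLen_removeHook_le (μ := μ)
      omega

theorem lt_card_largestHook (h0 : (0, 0) ∈ μ) {h : ℕ}
    (hh : h ∈ μ.removeHook.hookDecomposition) : h < μ.largestHook.card := by
  have h1 := lt_of_mem_hookDecomposition hh
  have h2 := card_largestHook_add_one h0
  have h3 := rowLen_removeHook_le (μ := μ)
  have h4 := colLen_removeHook_le (μ := μ)
  have h5 := zero_mem_iff_rowLen.1 h0
  have h6 := zero_mem_iff_colLen.1 h0
  omega

theorem card_cells_eq (μ : YoungDiagram) :
    μ.cells.card = μ.largestHook.card + μ.removeHook.cells.card := by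
  have hsub : μ.largestHook ⊆ μ.cells := by
    refine Finset.union_subset (fun c hc => ?_) fun c hc => ?_
    · exact (mem_cells c).2 (mem_row_iff.1 hc).1
    · exact (mem_cells c).2 (mem_col_iff.1 hc).1
  have hpos : ∀ c ∈ μ.cells \ μ.largestHook, 0 < c.1 ∧ 0 < c.2 := by
    intro c hc
    rw [Finset.mem_sdiff, mem_cells] at hc
    constructor <;> refine Nat.pos_of_ne_zero fun h => hc.2 (Finset.mem_union.2 ?_)
    · exact Or.inl (mem_row_iff.2 ⟨hc.1, h⟩)
    · exact Or.inr (mem_col_iff.2 ⟨hc.1, h⟩)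
  have himage : μ.removeHook.cells.card = (μ.cells \ μ.largestHook).card := by
    refine Finset.card_image_of_injOn fun c hc d hd hcd => ?_
    have h1 := hpos c hc
    have h2 := hpos d hd
    rw [Prod.mk.injEq] at hcd
    exact Prod.ext (by omega) (by omega)
  rw [himage, Finset.card_sdiff_of_subset hsub]
  have := Finset.card_le_card hsub
  omega

theorem card_cells_eq_sum_hookDecomposition (μ : YoungDiagram) :
    μ.cells.card = ∑ h ∈ μ.hookDecomposition, h := by
  induction hn : μ.durfeeSide generalizing μ with
  | zero =>
    have h0 : (0, 0) ∉ μ := fun h => by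
      have := lt_durfeeSide_iff.2 h
      omega
    rw [hookDecomposition_eq_empty_iff.2 h0, eq_bot_iff_zero_notMem.2 h0]
    simp
  | succ n ih =>
    have h0 : (0, 0) ∈ μ := lt_durfeeSide_iff.1 (by omega)
    have h1 := durfeeSide_eq_succ h0
    rw [hookDecomposition_eq_insert h0,
      Finset.sum_insert fun h => lt_irrefl _ (lt_card_largestHook h0 h), card_cells_eq,
      ih _ (by omega)]

/-- The Young diagram that is obtained by adding a hook with arm `a` and leg `b`. -/
def addHook (a b : ℕ) (ν : YoungDiagram) : YoungDiagram where
  cells := (Finset.range (b + 1) ×ˢ Finset.range (a + 1)).filter fun c =>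
    c.1 = 0 ∨ c.2 = 0 ∨ (c.1 - 1, c.2 - 1) ∈ ν.cells
  isLowerSet := by
    rintro ⟨x, y⟩ ⟨z, w⟩ hle h
    obtain ⟨h1, h2⟩ := Prod.mk_le_mk.1 hle
    simp only [Finset.coe_filter, Finset.mem_product, Finset.mem_range, Set.mem_ofPred_eq,
      mem_cells] at h ⊢
    refine ⟨by omega, ?_⟩
    rcases h.2 with h | h | h
    · exact Or.inl (by omega)
    · exact Or.inr (Or.inl (by omega))
    · exact Or.inr (Or.inr (ν.up_left_mem (by omega) (by omega) h))

theorem mem_addHook {a b x y : ℕ} :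
    (x, y) ∈ addHook a b ν ↔ (x ≤ b ∧ y ≤ a) ∧ (x = 0 ∨ y = 0 ∨ (x - 1, y - 1) ∈ ν) := by
  rw [← mem_cells]
  simp [addHook]

theorem rowLen_addHook (a b : ℕ) (ν : YoungDiagram) : (addHook a b ν).rowLen 0 = a + 1 := by
  refine eq_of_forall_lt_iff fun y => ?_
  rw [← mem_iff_lt_rowLen, mem_addHook]
  simp

theorem colLen_addHook (a b : ℕ) (ν : YoungDiagram) : (addHook a b ν).colLen 0 = b + 1 := by
  refine eq_of_forall_lt_iff fun x => ?_
  rw [← mem_iff_lt_colLen, mem_addHook]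
  simp

theorem removeHook_addHook {a b : ℕ} (ha : ν.rowLen 0 ≤ a) (hb : ν.colLen 0 ≤ b) :
    (addHook a b ν).removeHook = ν := by
  ext ⟨x, y⟩
  rw [mem_cells, mem_cells, mem_removeHook, mem_addHook]
  simp only [Nat.add_sub_cancel, Nat.add_eq_zero_iff, one_ne_zero, and_false, false_or,
    and_iff_right_iff_imp]
  intro h
  have h1 := mem_iff_lt_rowLen.1 (ν.up_left_mem (Nat.zero_le x) le_rfl h)
  have h2 := mem_iff_lt_colLen.1 (ν.up_left_mem le_rfl (Nat.zero_le y) h)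
  omega

theorem addHook_removeHook (h0 : (0, 0) ∈ μ) :
    addHook (μ.rowLen 0 - 1) (μ.colLen 0 - 1) μ.removeHook = μ := by
  have h1 := zero_mem_iff_rowLen.1 h0
  have h2 := zero_mem_iff_colLen.1 h0
  ext ⟨x, y⟩
  rw [mem_cells, mem_cells, mem_addHook, mem_removeHook]
  constructor
  · rintro ⟨⟨h3, h4⟩, h⟩
    obtain _ | x := x
    · exact mem_iff_lt_rowLen.2 (by omega)
    obtain _ | y := y
    · exact mem_iff_lt_colLen.2 (by omega)
    simpa using h
  · intro h
    have h3 := mem_iff_lt_rowLen.1 (μ.up_left_mem (Nat.zero_le x) le_rfl h)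
    have h4 := mem_iff_lt_colLen.1 (μ.up_left_mem le_rfl (Nat.zero_le y) h)
    refine ⟨by omega, ?_⟩
    obtain _ | x := x
    · exact Or.inl rfl
    obtain _ | y := y
    · exact Or.inr (Or.inl rfl)
    exact Or.inr (Or.inr h)

/-- The diagram has hook decomposition `S` and fits inside a box with `q` rows and `p` columns. -/
structure HasHooks (S : Finset ℕ) (p q : ℕ) (μ : YoungDiagram) : Prop where
  hooks : μ.hookDecomposition = S
  rowLen_le : μ.rowLen 0 ≤ p
  colLen_le : μ.colLen 0 ≤ q

namespace HasHooks

variable {S : Finset ℕ} {i p q : ℕ}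

theorem addHook (b : LegChoice i p q) (h : HasHooks S (i - 1 - b.1) b.1 ν) :
    HasHooks (insert i S) p q (ν.addHook (i - 1 - b.1) b.1) := by
  have hb := b.2
  have hrow := rowLen_addHook (i - 1 - b.1) b.1 ν
  have hcol := colLen_addHook (i - 1 - b.1) b.1 ν
  have h0 : (0, 0) ∈ ν.addHook (i - 1 - b.1) b.1 := zero_mem_iff_rowLen.2 (by omega)
  have h1 := card_largestHook_add_one h0
  refine ⟨?_, by omega, by omega⟩
  rw [hookDecomposition_eq_insert h0, removeHook_addHook h.rowLen_le h.colLen_le, h.hooks]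
  congr 1
  omega

theorem exists_addHook (hS : ∀ j ∈ S, j < i) (h : HasHooks (insert i S) p q μ) :
    ∃ b : LegChoice i p q, HasHooks S (i - 1 - b.1) b.1 μ.removeHook ∧
      μ.removeHook.addHook (i - 1 - b.1) b.1 = μ := by
  have h0 : (0, 0) ∈ μ := by
    by_contra h0
    have := hookDecomposition_eq_empty_iff.2 h0
    rw [h.hooks] at this
    exact Finset.insert_ne_empty _ _ this
  have h1 := zero_mem_iff_rowLen.1 h0
  have h2 := zero_mem_iff_colLen.1 h0
  have h3 := card_largestHook_add_one h0
  have h4 := h.hooks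
  have h5 := h.rowLen_le
  have h6 := h.colLen_le
  rw [hookDecomposition_eq_insert h0] at h4
  have hlt : ∀ j ∈ μ.removeHook.hookDecomposition, j < μ.largestHook.card := fun j =>
    lt_card_largestHook h0
  have hi : μ.largestHook.card = i := by
    have h7 : i ∈ insert μ.largestHook.card μ.removeHook.hookDecomposition :=
      h4 ▸ Finset.mem_insert_self i S
    have h8 : μ.largestHook.card ∈ insert i S := h4 ▸ Finset.mem_insert_self _ _
    rcases Finset.mem_insert.1 h7 with h7 | h7
    · exact h7.symm
    rcases Finset.mem_insert.1 h8 with h8 | h8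
    · exact h8
    exact absurd (hlt _ h7) (lt_asymm (hS _ h8))
  rw [hi] at h4 h3 hlt
  have hrem : μ.removeHook.hookDecomposition = S := by
    rw [← Finset.erase_insert fun h => lt_irrefl _ (hlt i h), h4,
      Finset.erase_insert fun h => lt_irrefl _ (hS i h)]
  have h7 := rowLen_removeHook_le (μ := μ)
  have h8 := colLen_removeHook_le (μ := μ)
  refine ⟨⟨μ.colLen 0 - 1, by omega, by omega, by omega⟩, ⟨hrem, ?_, ?_⟩, ?_⟩
  · dsimp only; omega
  · exact h8
  · dsimp only
    rw [show i - 1 - (μ.colLen 0 - 1) = μ.rowLen 0 - 1 by omega, addHook_removeHook h0]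

/-- Decomposition of Young diagrams at the largest hook. -/
theorem nonempty_equiv (hS : ∀ j ∈ S, j < i) :
    Nonempty ((Σ b : LegChoice i p q, {ν // HasHooks S (i - 1 - b.1) b.1 ν}) ≃
      {μ // HasHooks (insert i S) p q μ}) := by
  refine ⟨Equiv.ofBijective (fun x => ⟨_, x.2.2.addHook x.1⟩) ⟨?_, ?_⟩⟩
  · rintro ⟨b, ν, hν⟩ ⟨c, ξ, hξ⟩ he
    have he := Subtype.mk_eq_mk.1 he
    have hc := congrArg (fun μ => μ.colLen 0) he
    dsimp only at hc
    rw [colLen_addHook, colLen_addHook] at hc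
    obtain rfl : b = c := Subtype.ext (by omega)
    have hr := congrArg removeHook he
    rw [removeHook_addHook hν.rowLen_le hν.colLen_le,
      removeHook_addHook hξ.rowLen_le hξ.colLen_le] at hr
    subst hr
    rfl
  · rintro ⟨μ, hμ⟩
    obtain ⟨b, h1, h2⟩ := hμ.exists_addHook hS
    exact ⟨⟨b, _, h1⟩, Subtype.ext h2⟩

theorem hasHooks_empty_iff : HasHooks ∅ p q μ ↔ μ = ⊥ := by
  rw [eq_bot_iff_zero_notMem]
  constructor
  · exact fun h => hookDecomposition_eq_empty_iff.1 h.hooks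
  · intro h
    have h1 := mt zero_mem_iff_rowLen.2 h
    have h2 := mt zero_mem_iff_colLen.2 h
    exact ⟨hookDecomposition_eq_empty_iff.2 h, by omega, by omega⟩

end HasHooks

/-- Words with given peaks are equinumerous with Young diagrams with given hooks. -/
theorem nonempty_equiv_word_hasHooks (S : Finset ℕ) (hS : ∀ i ∈ S, 1 ≤ i) (p q : ℕ) :
    Nonempty ({Z // IsWord S p q Z} ≃ {μ // HasHooks S p q μ}) := by
  induction S using Finset.induction_on_max generalizing p q with
  | empty =>
    simp only [IsWord.isWord_empty_iff, HasHooks.hasHooks_empty_iff]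
    exact ⟨Equiv.ofUnique _ _⟩
  | insert i S hi ih =>
    obtain ⟨e⟩ := IsWord.nonempty_equiv (p := p) (q := q) (hS i (Finset.mem_insert_self i S)) hi
    obtain ⟨f⟩ := HasHooks.nonempty_equiv (p := p) (q := q) hi
    have ih := fun p q => ih (fun j hj => hS j (Finset.mem_insert_of_mem hj)) p q
    exact ⟨e.symm.trans ((Equiv.sigmaCongrRight fun b => (ih _ _).some).trans f)⟩

theorem sum_rowLens (μ : YoungDiagram) : μ.rowLens.sum = μ.cells.card := by
  rw [Finset.card_eq_sum_card_fiberwise (f := Prod.fst) (t := Finset.range (μ.colLen 0)),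
    rowLens]
  · change ∑ i ∈ Finset.range (μ.colLen 0), μ.rowLen i = _
    exact Finset.sum_congr rfl fun i _ => rowLen_eq_card μ
  · rintro ⟨x, y⟩ h
    exact Finset.mem_coe.2 (Finset.mem_range.2
      (mem_iff_lt_colLen.1 (μ.up_left_mem le_rfl (Nat.zero_le y) h)))

theorem cells_subset_box_iff {p q : ℕ} :
    μ.cells ⊆ Finset.range q ×ˢ Finset.range p ↔ μ.rowLen 0 ≤ p ∧ μ.colLen 0 ≤ q := by
  constructor
  · intro h
    constructor <;> by_contra! hlt
    · have := h ((mem_cells _).2 (mem_iff_lt_rowLen.2 hlt))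
      simp at this
    · have := h ((mem_cells _).2 (mem_iff_lt_colLen.2 hlt))
      simp at this
  · rintro ⟨h1, h2⟩ ⟨x, y⟩ h
    have h := (mem_cells _).1 h
    have h3 := mem_iff_lt_rowLen.1 (μ.up_left_mem (Nat.zero_le x) le_rfl h)
    have h4 := mem_iff_lt_colLen.1 (μ.up_left_mem le_rfl (Nat.zero_le y) h)
    simp only [Finset.mem_product, Finset.mem_range]
    omega

end YoungDiagram

namespace Nat.Partition

theorem youngDiagram_injective {m : ℕ} :
    Function.Injective (youngDiagram : Nat.Partition m → YoungDiagram) := by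
  intro p p' h
  have hlens : ∀ p : Nat.Partition m, p.youngDiagram.rowLens = p.parts.sort (· ≥ ·) := fun p =>
    YoungDiagram.rowLens_ofRowLens_eq_self fun x hx =>
      p.parts_pos ((Multiset.mem_sort (· ≥ ·)).1 hx)
  have h1 := hlens p
  rw [h, hlens p'] at h1
  ext1
  rw [← Multiset.sort_eq p.parts (· ≥ ·), ← h1, Multiset.sort_eq]

theorem exists_youngDiagram_eq (μ : YoungDiagram) :
    ∃ p : Nat.Partition μ.cells.card, p.youngDiagram = μ := by
  refine ⟨⟨μ.rowLens, fun {x} hx => μ.pos_of_mem_rowLens x hx, ?_⟩, ?_⟩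
  · rw [Multiset.sum_coe, μ.sum_rowLens]
  · have : (μ.rowLens : Multiset ℕ).sort (· ≥ ·) = μ.rowLens :=
      List.mergeSort_eq_self _ (by simpa using μ.rowLens_sorted.pairwise)
    simp only [youngDiagram, this]
    exact YoungDiagram.ofRowLens_to_rowLens_eq_self

theorem nonempty_equiv_hasHooks (n : ℕ) (S : Finset ℕ) :
    Nonempty ({p : Nat.Partition (∑ i ∈ S, i) // p.hookDecomposition = S ∧ p.FitsInBox n} ≃
      {μ // YoungDiagram.HasHooks S ((n + 1) / 2) (n / 2) μ}) := by
  have key : ∀ p : Nat.Partition (∑ i ∈ S, i), (p.hookDecomposition = S ∧ p.FitsInBox n) ↔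
      YoungDiagram.HasHooks S ((n + 1) / 2) (n / 2) p.youngDiagram := by
    intro p
    rw [FitsInBox, YoungDiagram.cells_subset_box_iff]
    exact ⟨fun h => ⟨h.1, h.2.1, h.2.2⟩, fun h => ⟨h.hooks, h.rowLen_le, h.colLen_le⟩⟩
  refine ⟨Equiv.ofBijective (fun p => ⟨p.1.youngDiagram, (key p.1).1 p.2⟩) ⟨?_, ?_⟩⟩
  · intro p p' h
    exact Subtype.ext (youngDiagram_injective (Subtype.mk_eq_mk.1 h))
  · rintro ⟨μ, hμ⟩
    have hcard : μ.cells.card = ∑ i ∈ S, i := by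
      rw [μ.card_cells_eq_sum_hookDecomposition, hμ.hooks]
    obtain ⟨p, hp⟩ : ∃ p : Nat.Partition (∑ i ∈ S, i), p.youngDiagram = μ :=
      hcard ▸ exists_youngDiagram_eq μ
    exact ⟨⟨p, (key p).2 (hp ▸ hμ)⟩, Subtype.ext hp⟩

end Nat.Partition

theorem mainTheorem5 (n : ℕ) (S : Finset ℕ) (hS : ∀ i ∈ S, 1 ≤ i ∧ i < n)
    (m : ℕ) (hm : m = ∑ i ∈ S, i) :
    ∃ f : {π : Equiv.Perm (Fin n) // π ∈ involutions123 n ∧ ascentSet π = S} →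
        {p : Nat.Partition m // p.hookDecomposition = S ∧ p.FitsInBox n},
      Function.Bijective f := by
  subst hm
  have hword := (card_involutions123_ascentSet n S).trans (card_ballot_eq_card_word n S)
  obtain ⟨e⟩ := Nat.Partition.nonempty_equiv_hasHooks n S
  obtain ⟨f⟩ := YoungDiagram.nonempty_equiv_word_hasHooks S (fun i hi => (hS i hi).1)
    ((n + 1) / 2) (n / 2)
  have : Finite {Z : Finset ℕ // IsWord S ((n + 1) / 2) (n / 2) Z} :=
    ((Finset.range _).powerset.finite_toSet.subset fun _ hZ =>
      Finset.mem_coe.2 (Finset.mem_powerset.2 (IsWord.subset hZ))).to_subtype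
  have g := (Finite.card_eq.1 hword).some
  exact ⟨_, (g.trans (f.trans e.symm)).bijective⟩
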